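/- Let $f,g\in C^\infty(\mathbb R^2)$ be functions of $(u,u_x)$, let $0<T<\infty$, and let $u(t,x)$ be a classical solution on $0\le t<T$, $x\in\mathbb R$, of the $fg$-equation $$m_t+f(u,u_x)\,m+\bigl(g(u,u_x)\,m\bigr)_x=0,\qquad m=u-u_{xx},$$ that is, $u\in C^0([0,T);H^3(\mathbb R))\cap C^1([0,T);H^2(\mathbb R))$ and the equation holds in $L^2(\mathbb R)$ for every $t\in[0,T)$. Put $\tilde D=u_x\partial_u+u\,\partial_{u_x}$ and $$A=A_0+A_1m+A_2m^2+A_3m^3,\qquad B=B_0+B_1m,$$ where $$A_0=2f-\tilde D^2f+\tilde D(g-\tilde D^2g),\qquad A_1=f_u+\tfrac53\tilde Df_{u_x}+\tfrac83\tilde Dg_u+\tfrac73\tilde D^2g_{u_x},$$ $$A_2=-\tfrac23f_{u_xu_x}-2g_{uu_x}-\tfrac{11}{6}\tilde Dg_{u_xu_x},\qquad A_3=\tfrac12g_{u_xu_xu_x},\qquad B_0=2f+3\tilde Dg,\qquad B_1=-5g_{u_x}.$$ Then: (i) $u$ blows up at time $T$, i.e. $\limsup_{t\to T^-}\|u(t)\|_{H^3(\mathbb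 R)}=\infty$, if and only if there are constants $\alpha,\beta\ge0$ (which may depend on the solution) such that $$\liminf_{t\to T^-}\ \inf_{x\in\mathbb R}\bigl(\alpha A+\beta B\bigr)=-\infty .$$ (ii) For every $t\in[0,T)$ (one-sided derivative at $t=0$), $$\frac{d}{dt}\int_{\mathbb R}(m^2+m_x^2)\,dx=-\int_{\mathbb R}(A\,m^2+B\,m_x^2)\,dx ,$$ where both integrands are integrable and $m_x$ is the weak $x$-derivative of $m$. -/

import Mathlib

open MeasureTheory Set Filter Topology
open scoped ContDiff ENNReal

noncomputable section

/-! ### Sobolev spaces on the real line -/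

/-- `w` is the weak derivative of `v` on `ℝ`. -/
def HasWeakDeriv (v w : ℝ → ℝ) : Prop :=
  LocallyIntegrable v volume ∧ LocallyIntegrable w volume ∧
    ∀ φ : ℝ → ℝ, ContDiff ℝ ∞ φ → HasCompactSupport φ →
      ∫ x, v x * deriv φ x = -∫ x, w x * φ x

/-- The real Hilbert space `L²(ℝ)`. -/
abbrev L2R : Type := Lp ℝ 2 (volume : Measure ℝ)

lemma HasWeakDeriv.congr {v w v' w' : ℝ → ℝ} (h : HasWeakDeriv v w)
    (hv : v =ᵐ[volume] v') (hw : w =ᵐ[volume] w') : HasWeakDeriv v' w' := by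
  refine ⟨h.1.congr hv, h.2.1.congr hw, fun φ h1 h2 => ?_⟩
  rw [← integral_congr_ae (hv.mono fun x hx => by simp only [hx] :
      (fun x => v x * deriv φ x) =ᵐ[volume] fun x => v' x * deriv φ x),
    ← integral_congr_ae (hw.mono fun x hx => by simp only [hx] :
      (fun x => w x * φ x) =ᵐ[volume] fun x => w' x * φ x)]
  exact h.2.2 φ h1 h2

lemma HasWeakDeriv.zero : HasWeakDeriv (0 : ℝ → ℝ) 0 :=
  ⟨locallyIntegrable_zero, locallyIntegrable_zero, fun φ _ _ => by simp⟩

lemma HasWeakDeriv.add {v w v' w' : ℝ → ℝ} (h : HasWeakDeriv v w) (h' : HasWeakDeriv v' w') :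
    HasWeakDeriv (v + v') (w + w') := by
  refine ⟨h.1.add h'.1, h.2.1.add h'.2.1, fun φ h1 h2 => ?_⟩
  have c1 : Continuous (deriv φ) := h1.continuous_deriv (by simp)
  have i1 : ∀ a : ℝ → ℝ, LocallyIntegrable a volume →
      Integrable (fun x => a x * deriv φ x) volume := fun a ha => by
    simpa [smul_eq_mul, mul_comm] using
      ha.integrable_smul_left_of_hasCompactSupport c1 h2.deriv
  have i2 : ∀ a : ℝ → ℝ, LocallyIntegrable a volume →
      Integrable (fun x => a x * φ x) volume := fun a ha => by
    simpa [smul_eq_mul, mul_comm] using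
      ha.integrable_smul_left_of_hasCompactSupport h1.continuous h2
  simp only [Pi.add_apply, add_mul]
  rw [integral_add (i1 _ h.1) (i1 _ h'.1), integral_add (i2 _ h.2.1) (i2 _ h'.2.1),
    h.2.2 φ h1 h2, h'.2.2 φ h1 h2]
  ring

lemma HasWeakDeriv.smul {v w : ℝ → ℝ} (c : ℝ) (h : HasWeakDeriv v w) :
    HasWeakDeriv (c • v) (c • w) := by
  refine ⟨h.1.smul c, h.2.1.smul c, fun φ h1 h2 => ?_⟩
  simp only [Pi.smul_apply, smul_eq_mul, mul_assoc, integral_const_mul]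
  rw [h.2.2 φ h1 h2]
  ring

/-- The Sobolev space `H^k(ℝ)`: an element is stored as the list `(v, v', …, v^(k))` of an `L²`
function and its weak derivatives, all in `L²`. The norm inherited from the `ℓ²`-product is the
usual one, `‖v‖² = ∑_{j ≤ k} ‖v^(j)‖²_{L²}`. -/
def SobolevH (k : ℕ) : Submodule ℝ (PiLp 2 (fun _ : Fin (k + 1) => L2R)) where
  carrier := {V | ∀ j : Fin k, HasWeakDeriv (V j.castSucc) (V j.succ)}
  zero_mem' := fun _ =>
    HasWeakDeriv.zero.congr (Lp.coeFn_zero ℝ 2 volume).symm (Lp.coeFn_zero ℝ 2 volume).symm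
  add_mem' := fun hV hW j =>
    ((hV j).add (hW j)).congr (Lp.coeFn_add _ _).symm (Lp.coeFn_add _ _).symm
  smul_mem' := fun c _ hV j =>
    ((hV j).smul c).congr (Lp.coeFn_smul _ _).symm (Lp.coeFn_smul _ _).symm

/-- The function `v : ℝ → ℝ` belongs to the class `V ∈ H^k(ℝ)`. -/
def Represents {k : ℕ} (v : ℝ → ℝ) (V : SobolevH k) : Prop :=
  v =ᵐ[volume] (V : PiLp 2 (fun _ : Fin (k + 1) => L2R)) 0

/-- The `H^k(ℝ)` norm of a function, equal to `∞` if the function is not in `H^k(ℝ)`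
(the class `V` that a function in `H^k(ℝ)` represents is unique). -/
def sobolevNorm (k : ℕ) (v : ℝ → ℝ) : ℝ≥0∞ :=
  ⨅ (V : SobolevH k) (_ : Represents v V), ‖V‖ₑ

/-- `u ∈ C^n(S; H^k(ℝ))`, where `u t x` is the value at time `t` and position `x`. -/
def MemCH (n k : ℕ) (S : Set ℝ) (u : ℝ → ℝ → ℝ) : Prop :=
  ∃ U : ℝ → SobolevH k, ContDiffOn ℝ n U S ∧ ∀ t ∈ S, Represents (u t) (U t)

/-! ### The equation `m_t + f(u,u_x) m + (g(u,u_x) m)_x = 0` -/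

/-- The momentum `m = v - v_xx`. -/
def momentum (v : ℝ → ℝ) (x : ℝ) : ℝ := v x - deriv (deriv v) x

/-- The point `(v, v_x)` at which `f`, `g` and their derivatives are evaluated. -/
def jet (v : ℝ → ℝ) (x : ℝ) : ℝ × ℝ := (v x, deriv v x)

/-- Classical solutions on `[0,T)`: `u ∈ C⁰([0,T); H³(ℝ)) ∩ C¹([0,T); H²(ℝ))`, where `u(t,·)` is the
`C²` representative of its class in `H³(ℝ)`, and the equation holds in `L²(ℝ)` at every time:
`m` is a differentiable curve in `L²(ℝ)`, and `-(m_t + f(u,u_x) m)` is the `x`-derivative of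
`g(u,u_x) m`. -/
structure IsClassicalSolution (f g : ℝ × ℝ → ℝ) (T : ℝ) (u : ℝ → ℝ → ℝ) : Prop where
  contDiff_two : ∀ t ∈ Ico 0 T, ContDiff ℝ 2 (u t)
  mem_H3 : MemCH 0 3 (Ico 0 T) u
  mem_H2 : MemCH 1 2 (Ico 0 T) u
  equation : ∃ M Mt : ℝ → L2R, ∀ t ∈ Ico 0 T,
    momentum (u t) =ᵐ[volume] M t ∧
    HasDerivWithinAt M (Mt t) (Ico 0 T) t ∧
    HasWeakDeriv (fun x => g (jet (u t) x) * momentum (u t) x)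
      (fun x => -(Mt t x + f (jet (u t) x) * momentum (u t) x))

/-- Blow-up at time `T`: `limsup_{t → T⁻} ‖u(t)‖_{H³} = ∞`. -/
def BlowsUpAt (T : ℝ) (u : ℝ → ℝ → ℝ) : Prop :=
  limsup (fun t => sobolevNorm 3 (u t)) (𝓝[<] T) = ⊤

/-! ### The coefficients `A` and `B` -/

/-- `∂F/∂u` for a function `F` of `(u, u_x)`. -/
def dU (F : ℝ × ℝ → ℝ) (p : ℝ × ℝ) : ℝ := fderiv ℝ F p (1, 0)

/-- `∂F/∂u_x` for a function `F` of `(u, u_x)`. -/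
def dUx (F : ℝ × ℝ → ℝ) (p : ℝ × ℝ) : ℝ := fderiv ℝ F p (0, 1)

/-- `D̃ = u_x ∂_u + u ∂_{u_x}`. -/
def tilD (F : ℝ × ℝ → ℝ) (p : ℝ × ℝ) : ℝ := p.2 * dU F p + p.1 * dUx F p

def coeffA0 (f g : ℝ × ℝ → ℝ) (p : ℝ × ℝ) : ℝ :=
  2 * f p - tilD (tilD f) p + tilD (fun q => g q - tilD (tilD g) q) p

def coeffA1 (f g : ℝ × ℝ → ℝ) (p : ℝ × ℝ) : ℝ :=
  dU f p + 5 / 3 * tilD (dUx f) p + 8 / 3 * tilD (dU g) p + 7 / 3 * tilD (tilD (dUx g)) p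

def coeffA2 (f g : ℝ × ℝ → ℝ) (p : ℝ × ℝ) : ℝ :=
  -(2 / 3) * dUx (dUx f) p - 2 * dUx (dU g) p - 11 / 6 * tilD (dUx (dUx g)) p

def coeffA3 (g : ℝ × ℝ → ℝ) (p : ℝ × ℝ) : ℝ := 1 / 2 * dUx (dUx (dUx g)) p

def coeffB0 (f g : ℝ × ℝ → ℝ) (p : ℝ × ℝ) : ℝ := 2 * f p + 3 * tilD g p

def coeffB1 (g : ℝ × ℝ → ℝ) (p : ℝ × ℝ) : ℝ := -5 * dUx g p

/-- `A = A₀ + A₁ m + A₂ m² + A₃ m³` along the function `v = u(t,·)`. -/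
def funA (f g : ℝ × ℝ → ℝ) (v : ℝ → ℝ) (x : ℝ) : ℝ :=
  coeffA0 f g (jet v x) + coeffA1 f g (jet v x) * momentum v x
    + coeffA2 f g (jet v x) * momentum v x ^ 2 + coeffA3 g (jet v x) * momentum v x ^ 3

/-- `B = B₀ + B₁ m` along the function `v = u(t,·)`. -/
def funB (f g : ℝ × ℝ → ℝ) (v : ℝ → ℝ) (x : ℝ) : ℝ :=
  coeffB0 f g (jet v x) + coeffB1 g (jet v x) * momentum v x

end

/-! Everything rests on the balance law for `E = ∫ (m² + m_x²)`. Since `u_xx = u - m`, the chain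
rule reads `F(u,u_x)_x = D̃F - F_{u_x} m`, and the equation becomes `m_t = -(S + g m_x)`, where `S`
is a polynomial in `m` with coefficients depending on `(u,u_x)`. Differentiating `E` formally leaves
terms `c m^j m_x` with weight `m` and `j = 0, 1, 2`; writing `m^(j+1) m_x = (m^(j+2))_x / (j+2)` and
integrating by parts produces exactly `A` and `B` (`energy_identity`).

The formal computation needs care because `m_t` is only in `L²`, so `m_x` is not known to be
differentiable in time. It is replaced by the difference quotient `D_h m`, with `D_h` bounded on
`L²`. The term containing `D_h m_x` is removed by parts (`two_inner_diffQuot`), what remains is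
bounded independently of `h`, and `h → 0` is taken under the time integral
(`norm_sq_sub_eq_integral`). Derivatives in `x` are treated as generators of the translation group,
on `L²` and on bounded continuous functions; integration by parts is then the invariance of the
inner product under translation.

For blow-up: if `A` and `B` are bounded below near `T`, the balance gives `E' ≤ C E`, so Gronwall
bounds `E`, which controls the `H³` norm (`SobolevH.norm_sq_le`). Conversely, an `H³` bound makes
`u`, `u_x` and `m` uniformly bounded by the embedding of `H¹` (`HasStrongDeriv.sq_le`), hence also
`A` and `B` (`exists_bound_coef`). -/

open scoped BoundedContinuousFunction RealInnerProductSpace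

noncomputable section

/-! ### One-parameter groups of isometries -/

section IsometryGroup

variable {X : Type*} [NormedAddCommGroup X] [NormedSpace ℝ X] {S : ℝ → X →ₗᵢ[ℝ] X}

lemma hasDerivAt_isometryGroup (hadd : ∀ h k x, S (h + k) x = S h (S k x)) {x y : X}
    (hx : HasDerivAt (fun h => S h x) y 0) (k : ℝ) : HasDerivAt (fun h => S h x) (S k y) k := by
  have h1 : HasDerivAt (fun h => S (h - k) x) y k := by
    have : HasDerivAt (fun h => S h x) y (k - k) := by simpa using hx
    exact this.comp_sub_const k k
  have h2 := (S k).toContinuousLinearMap.hasFDerivAt.comp_hasDerivAt k h1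
  refine h2.congr_of_eventuallyEq (Eventually.of_forall fun h => ?_)
  have := hadd k (h - k) x
  simpa using this

/-- The orbit has velocity `S h y`, of constant norm `‖y‖`, so the mean value inequality applies.
This is the source of all bounds on difference quotients that are uniform in `h`. -/
lemma norm_isometryGroup_sub_le (hadd : ∀ h k x, S (h + k) x = S h (S k x))
    (hzero : ∀ x, S 0 x = x) {x y : X}
    (hx : HasDerivAt (fun h => S h x) y 0) (h : ℝ) : ‖S h x - x‖ ≤ ‖y‖ * |h| := by
  have := convex_univ.norm_image_sub_le_of_norm_hasDerivWithin_le (f := fun h => S h x)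
    (f' := fun h => S h y) (C := ‖y‖) (x := 0) (y := h)
    (fun k _ => (hasDerivAt_isometryGroup hadd hx k).hasDerivWithinAt)
    (fun k _ => by simp) (mem_univ _) (mem_univ _)
  simpa [hzero] using this

end IsometryGroup

/-! ### Translations of `L²` functions and of bounded continuous functions -/

/-- Translation `M ↦ M (· + h)` on `L²(ℝ)`. -/
def shift (h : ℝ) : L2R →ₗᵢ[ℝ] L2R :=
  Lp.compMeasurePreservingₗᵢ ℝ (fun x => x + h) (measurePreserving_add_right volume h)

lemma shift_coe (h : ℝ) (M : L2R) : shift h M =ᵐ[volume] fun x => M (x + h) :=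
  Lp.coeFn_compMeasurePreserving M (measurePreserving_add_right volume h)

lemma ae_comp_add {v w : ℝ → ℝ} (hvw : v =ᵐ[volume] w) (h : ℝ) :
    (fun x => v (x + h)) =ᵐ[volume] fun x => w (x + h) :=
  (measurePreserving_add_right volume h).quasiMeasurePreserving.ae_eq_comp hvw

lemma shift_add (h k : ℝ) (M : L2R) : shift (h + k) M = shift h (shift k M) := by
  apply Lp.ext
  filter_upwards [shift_coe (h + k) M, shift_coe h (shift k M), ae_comp_add (shift_coe k M) h]
    with x h1 h2 h3
  rw [h1, h2, h3, add_assoc]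

lemma shift_zero (M : L2R) : shift 0 M = M := by
  apply Lp.ext
  filter_upwards [shift_coe 0 M] with x h1
  rw [h1, add_zero]

lemma continuous_shift (M : L2R) : Continuous fun h => shift h M := by
  let c : C(ℝ, C(ℝ, ℝ)) :=
    (ContinuousMap.mk (fun a : ℝ × ℝ => a.2 + a.1) (by fun_prop)).curry
  exact (continuous_const (y := M)).compMeasurePreservingLp c.continuous
    (fun h => measurePreserving_add_right volume h) (by simp)

/-- Translation `a ↦ a (· + h)` on bounded continuous functions. -/
def bshift (h : ℝ) : (ℝ →ᵇ ℝ) →ₗᵢ[ℝ] (ℝ →ᵇ ℝ) where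
  toFun a := a.compContinuous ⟨fun x => x + h, by fun_prop⟩
  map_add' _ _ := by ext; simp
  map_smul' _ _ := by ext; simp
  norm_map' a := by
    refine le_antisymm (a.norm_compContinuous_le _) ?_
    refine (BoundedContinuousFunction.norm_le (norm_nonneg _)).2 fun x => ?_
    have := (a.compContinuous ⟨fun x => x + h, by fun_prop⟩).norm_coe_le_norm (x - h)
    simpa using this

@[simp] lemma bshift_apply (h : ℝ) (a : ℝ →ᵇ ℝ) (x : ℝ) : bshift h a x = a (x + h) := rfl

lemma bshift_add (h k : ℝ) (a : ℝ →ᵇ ℝ) : bshift (h + k) a = bshift h (bshift k a) := by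
  ext x; simp [add_assoc]

lemma bshift_zero (a : ℝ →ᵇ ℝ) : bshift 0 a = a := by
  ext x; simp

lemma bshift_mul (h : ℝ) (a b : ℝ →ᵇ ℝ) : bshift h (a * b) = bshift h a * bshift h b := by
  ext x; simp

/-! ### Multiplication of `L²` functions by bounded continuous functions -/

lemma memLp_bcf_mul (a : ℝ →ᵇ ℝ) (M : L2R) : MemLp (fun x => a x * M x) 2 volume :=
  (Lp.memLp M).of_le_mul (c := ‖a‖)
    (a.continuous.aestronglyMeasurable.mul (Lp.aestronglyMeasurable M))
    (Eventually.of_forall fun x => by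
      rw [norm_mul]; gcongr; exact a.norm_coe_le_norm x)

/-- Multiplication `(a, M) ↦ a M` as a continuous bilinear map. -/
def mulB : (ℝ →ᵇ ℝ) →L[ℝ] L2R →L[ℝ] L2R :=
  LinearMap.mkContinuous₂
    (LinearMap.mk₂ ℝ (fun a M => (memLp_bcf_mul a M).toLp _)
      (fun a b M => by
        apply Lp.ext
        filter_upwards [(memLp_bcf_mul (a + b) M).coeFn_toLp, (memLp_bcf_mul a M).coeFn_toLp,
          (memLp_bcf_mul b M).coeFn_toLp, Lp.coeFn_add ((memLp_bcf_mul a M).toLp _)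
          ((memLp_bcf_mul b M).toLp _)] with x h1 h2 h3 h4
        rw [h1, h4, Pi.add_apply, h2, h3]; simp [add_mul])
      (fun c a M => by
        apply Lp.ext
        filter_upwards [(memLp_bcf_mul (c • a) M).coeFn_toLp, (memLp_bcf_mul a M).coeFn_toLp,
          Lp.coeFn_smul c ((memLp_bcf_mul a M).toLp _)] with x h1 h2 h3
        rw [h1, h3, Pi.smul_apply, h2]; simp [mul_assoc])
      (fun a M N => by
        apply Lp.ext
        filter_upwards [(memLp_bcf_mul a (M + N)).coeFn_toLp, (memLp_bcf_mul a M).coeFn_toLp,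
          (memLp_bcf_mul a N).coeFn_toLp, Lp.coeFn_add ((memLp_bcf_mul a M).toLp _)
          ((memLp_bcf_mul a N).toLp _), Lp.coeFn_add M N] with x h1 h2 h3 h4 h5
        rw [h1, h4, Pi.add_apply, h2, h3, h5]; simp [mul_add])
      (fun c a M => by
        apply Lp.ext
        filter_upwards [(memLp_bcf_mul a (c • M)).coeFn_toLp, (memLp_bcf_mul a M).coeFn_toLp,
          Lp.coeFn_smul c ((memLp_bcf_mul a M).toLp _), Lp.coeFn_smul c M] with x h1 h2 h3 h4
        rw [h1, h3, Pi.smul_apply, h2, h4]; simp [mul_left_comm])) 1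
    (fun a M => by
      rw [one_mul]
      refine Lp.norm_le_mul_norm_of_ae_le_mul ?_
      filter_upwards [(memLp_bcf_mul a M).coeFn_toLp] with x hx
      simp only [LinearMap.mk₂_apply, hx, norm_mul]
      gcongr
      exact a.norm_coe_le_norm x)

lemma mulB_coe (a : ℝ →ᵇ ℝ) (M : L2R) : mulB a M =ᵐ[volume] fun x => a x * M x :=
  (memLp_bcf_mul a M).coeFn_toLp

lemma norm_mulB_le (a : ℝ →ᵇ ℝ) (M : L2R) : ‖mulB a M‖ ≤ ‖a‖ * ‖M‖ := by
  refine Lp.norm_le_mul_norm_of_ae_le_mul ?_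
  filter_upwards [mulB_coe a M] with x hx
  rw [hx, norm_mul]
  gcongr
  exact a.norm_coe_le_norm x

lemma mulB_mul (a b : ℝ →ᵇ ℝ) (M : L2R) : mulB (a * b) M = mulB a (mulB b M) := by
  apply Lp.ext
  filter_upwards [mulB_coe (a * b) M, mulB_coe a (mulB b M), mulB_coe b M] with x h1 h2 h3
  rw [h1, h2, h3]; simp [mul_assoc]

lemma shift_mulB (h : ℝ) (a : ℝ →ᵇ ℝ) (M : L2R) :
    shift h (mulB a M) = mulB (bshift h a) (shift h M) := by
  apply Lp.ext
  filter_upwards [mulB_coe (bshift h a) (shift h M), shift_coe h (mulB a M), shift_coe h M,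
    ae_comp_add (mulB_coe a M) h] with x h1 h2 h3 h4
  rw [h1, h2, h3, h4]; simp

lemma inner_L2R (M N : L2R) : ⟪M, N⟫ = ∫ x, M x * N x := by
  rw [L2.inner_def]
  refine integral_congr_ae (Eventually.of_forall fun x => ?_)
  simp [mul_comm]

lemma integrable_mul_L2R (M N : L2R) : Integrable fun x => M x * N x :=
  (Lp.memLp M).integrable_mul (Lp.memLp N)

lemma integrable_mulB (a : ℝ →ᵇ ℝ) (M N : L2R) : Integrable fun x => a x * (M x * N x) := by
  refine (integrable_mul_L2R (mulB a M) N).congr ?_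
  filter_upwards [mulB_coe a M] with x hx
  rw [hx, mul_assoc]

lemma inner_mulB (a : ℝ →ᵇ ℝ) (M N : L2R) : ⟪mulB a M, N⟫ = ∫ x, a x * (M x * N x) := by
  rw [inner_L2R]
  refine integral_congr_ae ?_
  filter_upwards [mulB_coe a M] with x hx
  rw [hx, mul_assoc]

lemma inner_mulB_comm (a : ℝ →ᵇ ℝ) (M N : L2R) : ⟪mulB a M, N⟫ = ⟪M, mulB a N⟫ := by
  rw [real_inner_comm (mulB a N), inner_mulB, inner_mulB]
  simp only [mul_comm]

/-- If `a` and `b` are representatives of `M` and `N`, then `a N = b M`. -/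
lemma mulB_swap {a b : ℝ →ᵇ ℝ} {M N : L2R} (ha : a =ᵐ[volume] M) (hb : b =ᵐ[volume] N) :
    mulB a N = mulB b M := by
  apply Lp.ext
  filter_upwards [mulB_coe a N, mulB_coe b M, ha, hb] with x h1 h2 h3 h4
  rw [h1, h2, ← h3, ← h4, mul_comm]

/-! ### Derivatives along translations -/

/-- `W` is the derivative of `M` in `L²(ℝ)`, as the limit of difference quotients. -/
def HasStrongDeriv (M W : L2R) : Prop := HasDerivAt (fun h => shift h M) W 0

/-- `a'` is the uniform limit of the difference quotients of `a`. -/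
def HasUniformDeriv (a a' : ℝ →ᵇ ℝ) : Prop := HasDerivAt (fun h => bshift h a) a' 0

namespace HasStrongDeriv

variable {M W N Z : L2R} {a a' : ℝ →ᵇ ℝ}

lemma hasDerivAt_shift (hM : HasStrongDeriv M W) (k : ℝ) :
    HasDerivAt (fun h => shift h M) (shift k W) k :=
  hasDerivAt_isometryGroup shift_add hM k

lemma norm_shift_sub_le (hM : HasStrongDeriv M W) (h : ℝ) : ‖shift h M - M‖ ≤ ‖W‖ * |h| :=
  norm_isometryGroup_sub_le shift_add shift_zero hM h

lemma unique (hM : HasStrongDeriv M W) (hM' : HasStrongDeriv M Z) : W = Z :=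
  HasDerivAt.unique hM hM'

lemma sub (hM : HasStrongDeriv M W) (hN : HasStrongDeriv N Z) :
    HasStrongDeriv (M - N) (W - Z) := by
  simpa [HasStrongDeriv, Pi.sub_def] using HasDerivAt.sub hM hN

lemma smul (c : ℝ) (hM : HasStrongDeriv M W) : HasStrongDeriv (c • M) (c • W) := by
  simpa [HasStrongDeriv, Pi.smul_def] using HasDerivAt.const_smul c hM

lemma shifted (k : ℝ) (hM : HasStrongDeriv M W) : HasStrongDeriv (shift k M) (shift k W) := by
  have := hM.hasDerivAt_shift k
  have h2 : HasDerivAt (fun h => shift h M) (shift k W) (0 + k) := by simpa using this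
  have h3 := h2.comp_add_const 0 k
  simpa [HasStrongDeriv, shift_add] using h3

lemma bcf_mul (ha : HasUniformDeriv a a') (hM : HasStrongDeriv M W) :
    HasStrongDeriv (mulB a M) (mulB a' M + mulB a W) := by
  have h := mulB.hasFDerivAt_of_bilinear ha.hasFDerivAt hM.hasFDerivAt
  have h' := h.hasDerivAt
  simp only [← shift_mulB] at h'
  refine h'.congr_deriv ?_
  simp [bshift_zero, shift_zero, add_comm]

/-- Translations preserve the inner product, so `h ↦ ⟪shift h M, shift h N⟫` is constant; its
derivative at `0` is integration by parts, without boundary terms. -/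
lemma inner_add_inner (hM : HasStrongDeriv M W) (hN : HasStrongDeriv N Z) :
    ⟪W, N⟫ + ⟪M, Z⟫ = 0 := by
  have h := HasDerivAt.inner ℝ hM hN
  simp only [LinearIsometry.inner_map_map, shift_zero] at h
  have := h.unique (hasDerivAt_const 0 ⟪M, N⟫)
  linarith

/-- Integration by parts. -/
lemma inner_mulB_add (ha : HasUniformDeriv a a') (hM : HasStrongDeriv M W)
    (hN : HasStrongDeriv N Z) :
    ⟪mulB a' M, N⟫ + ⟪mulB a W, N⟫ + ⟪mulB a M, Z⟫ = 0 := by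
  have := (hM.bcf_mul ha).inner_add_inner hN
  rwa [inner_add_left] at this

end HasStrongDeriv

namespace HasUniformDeriv

variable {a a' : ℝ →ᵇ ℝ}

lemma norm_bshift_sub_le (ha : HasUniformDeriv a a') (h : ℝ) : ‖bshift h a - a‖ ≤ ‖a'‖ * |h| :=
  norm_isometryGroup_sub_le bshift_add bshift_zero ha h

lemma bshifted (k : ℝ) (ha : HasUniformDeriv a a') :
    HasUniformDeriv (bshift k a) (bshift k a') := by
  have := hasDerivAt_isometryGroup bshift_add ha k
  have h2 : HasDerivAt (fun h => bshift h a) (bshift k a') (0 + k) := by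
    simpa using this
  have h3 := h2.comp_add_const 0 k
  simpa [HasUniformDeriv, bshift_add] using h3

/-- A `C¹` function with bounded uniformly continuous derivative. -/
lemma of_hasDerivAt (hd : ∀ x, HasDerivAt a (a' x) x)
    (hc : Tendsto (fun h => bshift h a') (𝓝 0) (𝓝 a')) : HasUniformDeriv a a' := by
  rw [HasUniformDeriv, hasDerivAt_iff_isLittleO, Asymptotics.isLittleO_iff]
  intro ε hε
  obtain ⟨δ, hδ, hball⟩ := Metric.eventually_nhds_iff.1 (Metric.tendsto_nhds.1 hc ε hε)
  refine Metric.eventually_nhds_iff.2 ⟨δ, hδ, fun h hh => ?_⟩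
  refine (BoundedContinuousFunction.norm_le (by positivity)).2 fun x => ?_
  -- Subtracting the linear part leaves the derivative `a' (x + k) - a' x`, which is at most `ε` for
  -- all `x` at once.
  have key := (convex_ball (0 : ℝ) δ).norm_image_sub_le_of_norm_hasDerivWithin_le
    (f := fun k => a (x + k) - k * a' x) (f' := fun k => a' (x + k) - a' x) (C := ε)
    (x := 0) (y := h)
    (fun k _ => by
      have h1 : HasDerivAt (fun k => a (x + k)) (a' (x + k)) k := (hd (x + k)).comp_const_add x k
      have h2 : HasDerivAt (fun k => k * a' x) (a' x) k := by
        simpa using (hasDerivAt_id k).mul_const (a' x)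
      exact (h1.sub h2).hasDerivWithinAt)
    (fun k hk => by
      have h1 := (hball hk).le
      rw [dist_eq_norm] at h1
      exact ((bshift k a' - a').norm_coe_le_norm x).trans h1)
    (by simpa using hδ) hh
  have e : a (x + h) - h * a' x - (a (x + 0) - 0 * a' x)
      = a (x + h) - a x - h * a' x := by simp; ring
  rw [e] at key
  simpa [bshift_zero] using key

end HasUniformDeriv

/-! ### Weak derivatives -/

lemma locallyIntegrable_L2R (M : L2R) : LocallyIntegrable M volume :=
  (Lp.memLp M).locallyIntegrable (by norm_num)

lemma memLp_test {φ : ℝ → ℝ} (h1 : ContDiff ℝ ∞ φ) (h2 : HasCompactSupport φ) :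
    MemLp φ 2 volume :=
  h1.continuous.memLp_of_hasCompactSupport h2

lemma HasWeakDeriv.unique {v w w' : ℝ → ℝ} (h : HasWeakDeriv v w) (h' : HasWeakDeriv v w') :
    w =ᵐ[volume] w' := by
  refine ae_eq_of_integral_contDiff_smul_eq h.2.1 h'.2.1 fun φ h1 h2 => ?_
  have e1 := h.2.2 φ h1 h2
  have e2 := h'.2.2 φ h1 h2
  simp only [smul_eq_mul, mul_comm (φ _)]
  linarith

lemma HasWeakDeriv.of_contDiff {v : ℝ → ℝ} (hv : ContDiff ℝ 1 v) : HasWeakDeriv v (deriv v) := by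
  have hc : Continuous (deriv v) := hv.continuous_deriv (by simp)
  refine ⟨hv.continuous.locallyIntegrable, hc.locallyIntegrable, fun φ h1 h2 => ?_⟩
  have c1 : Continuous (deriv φ) := h1.continuous_deriv (by simp)
  have d1 : ∀ x, HasDerivAt φ (deriv φ x) x := fun x =>
    ((h1.differentiable (by simp)) x).hasDerivAt
  have d2 : ∀ x, HasDerivAt v (deriv v x) x := fun x =>
    ((hv.differentiable (by simp)) x).hasDerivAt
  refine integral_mul_deriv_eq_deriv_mul_of_integrable (fun x _ => d2 x) (fun x _ => d1 x) ?_ ?_ ?_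
  · exact (hv.continuous.mul c1).integrable_of_hasCompactSupport h2.deriv.mul_left
  · exact (hc.mul h1.continuous).integrable_of_hasCompactSupport h2.mul_left
  · exact (hv.continuous.mul h1.continuous).integrable_of_hasCompactSupport h2.mul_left

lemma L2R_eq_of_inner_test {M N : L2R}
    (h : ∀ φ : ℝ → ℝ, ∀ (h1 : ContDiff ℝ ∞ φ) (h2 : HasCompactSupport φ),
      ⟪(memLp_test h1 h2).toLp φ, M⟫ = ⟪(memLp_test h1 h2).toLp φ, N⟫) : M = N := by
  apply Lp.ext
  refine ae_eq_of_integral_contDiff_smul_eq (locallyIntegrable_L2R M) (locallyIntegrable_L2R N)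
    fun φ h1 h2 => ?_
  have e : ∀ K : L2R, ∫ x, φ x • K x = ⟪(memLp_test h1 h2).toLp φ, K⟫ := fun K => by
    rw [inner_L2R]
    refine integral_congr_ae ?_
    filter_upwards [(memLp_test h1 h2).coeFn_toLp] with x hx
    rw [hx, smul_eq_mul]
  rw [e, e, h φ h1 h2]

/-- A weak derivative in `L²` is the derivative of the pairing with a translated test function. -/
lemma HasWeakDeriv.hasDerivAt_inner_shift {M W : L2R} (hM : HasWeakDeriv M W) {φ : ℝ → ℝ}
    (h1 : ContDiff ℝ ∞ φ) (h2 : HasCompactSupport φ) (θ : ℝ) :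
    HasDerivAt (fun h => ⟪(memLp_test h1 h2).toLp φ, shift h M⟫)
      ⟪(memLp_test h1 h2).toLp φ, shift θ W⟫ θ := by
  -- A change of variables moves the translation onto `φ`; the pairing is then a convolution with
  -- the reflected test function and is differentiated on the smooth factor.
  have e : ∀ (K : L2R) (h : ℝ), ⟪(memLp_test h1 h2).toLp φ, shift h K⟫ = ∫ y, K y * φ (y - h) := by
    intro K h
    rw [inner_L2R, ← integral_add_right_eq_self (fun y => K y * φ (y - h)) h]
    refine integral_congr_ae ?_
    filter_upwards [(memLp_test h1 h2).coeFn_toLp, shift_coe h K] with x hx hx'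
    rw [hx, hx']
    simp [mul_comm]
  have r1 : ContDiff ℝ ∞ (fun z => φ (-z)) := h1.comp contDiff_neg
  have r2 : HasCompactSupport (fun z => φ (-z)) := h2.comp_homeomorph (Homeomorph.neg ℝ)
  have hd := r2.hasDerivAt_convolution_right (ContinuousLinearMap.mul ℝ ℝ) (μ := volume)
    (locallyIntegrable_L2R M) (r1.of_le (by simp)) θ
  simp only [e]
  have s1 : ContDiff ℝ ∞ (fun y => φ (y - θ)) := h1.comp (contDiff_id.sub contDiff_const)
  have s2 : HasCompactSupport (fun y => φ (y - θ)) := by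
    simpa [sub_eq_add_neg, Function.comp_def] using h2.comp_homeomorph (Homeomorph.addRight (-θ))
  have hw := hM.2.2 _ s1 s2
  refine (hd.congr_deriv ?_).congr_of_eventuallyEq (Eventually.of_forall fun h => ?_)
  · rw [← neg_eq_iff_eq_neg.2 hw, ← integral_neg]
    unfold convolution
    refine integral_congr_ae (Eventually.of_forall fun y => ?_)
    simp [deriv_comp_neg, deriv_comp_sub_const]
  · simp [convolution]

lemma HasWeakDeriv.shift_sub_eq {M W : L2R} (hM : HasWeakDeriv M W) (h : ℝ) :
    shift h M - M = ∫ θ in (0 : ℝ)..h, shift θ W := by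
  refine L2R_eq_of_inner_test fun φ h1 h2 => ?_
  set Φ := (memLp_test h1 h2).toLp φ
  have hc : Continuous fun θ => ⟪Φ, shift θ W⟫ := continuous_const.inner (continuous_shift W)
  have ftc := intervalIntegral.integral_eq_sub_of_hasDerivAt
    (fun θ _ => hM.hasDerivAt_inner_shift h1 h2 θ) (hc.intervalIntegrable 0 h)
  have := (innerSL ℝ Φ).intervalIntegral_comp_comm
    ((continuous_shift W).intervalIntegrable (μ := volume) 0 h)
  simp only [innerSL_apply_apply] at this
  rw [← this, ftc, shift_zero, inner_sub_right]

/-- By `shift_sub_eq` the difference quotient is the average of `shift θ W` over `θ` between `0` and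
`h`, which tends to `W` by strong continuity of translations. -/
lemma HasWeakDeriv.hasStrongDeriv {M W : L2R} (hM : HasWeakDeriv M W) : HasStrongDeriv M W := by
  have h := (continuous_shift W).integral_hasStrictDerivAt 0 0
  have h' := h.hasDerivAt.add_const M
  rw [shift_zero] at h'
  refine h'.congr_of_eventuallyEq (Eventually.of_forall fun k => ?_)
  simp [← hM.shift_sub_eq k]

/-! ### The embedding of `H¹(ℝ)` into the bounded continuous functions -/

/-- A smooth cutoff function, increasing from `0` to `1` near `x₀`. -/
lemma exists_smooth_step (x₀ : ℝ) {r : ℝ} (hr : 0 < r) :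
    ∃ G η : ℝ →ᵇ ℝ, HasUniformDeriv G η ∧ ‖G‖ ≤ 1 ∧ (∀ x, 0 ≤ η x) ∧
      (∀ x, x ∉ Metric.ball x₀ r → η x = 0) ∧ Integrable η ∧ ∫ x, η x = 1 := by
  let b : ContDiffBump x₀ := ⟨r / 2, r, by positivity, by linarith⟩
  let e : ℝ → ℝ := b.normed volume
  have ec : Continuous e := b.continuous_normed
  have es : HasCompactSupport e := b.hasCompactSupport_normed
  have e0 : ∀ x, 0 ≤ e x := b.nonneg_normed
  have ei : Integrable e := ec.integrable_of_hasCompactSupport es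
  have e1 : ∫ x, e x = 1 := b.integral_normed
  obtain ⟨C, hC⟩ := es.exists_bound_of_continuous ec
  let η : ℝ →ᵇ ℝ := BoundedContinuousFunction.ofNormedAddCommGroup e ec C hC
  let G : ℝ → ℝ := fun x => ∫ y in Iic x, e y
  have hG : ∀ x, HasDerivAt G (e x) x := fun x => by
    have h := (ec.integral_hasStrictDerivAt 0 x).hasDerivAt.add_const (∫ y in Iic (0 : ℝ), e y)
    refine h.congr_of_eventuallyEq (Eventually.of_forall fun y => ?_)
    have := intervalIntegral.integral_Iic_sub_Iic (a := 0) (b := y) (ei.integrableOn) ei.integrableOn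
    simp only [G, ← this]; ring
  have hG0 : ∀ x, ‖G x‖ ≤ 1 := fun x => by
    rw [Real.norm_of_nonneg (integral_nonneg e0), ← e1]
    exact setIntegral_le_integral ei (Eventually.of_forall e0)
  have Gc : Continuous G := continuous_iff_continuousAt.2 fun x => (hG x).continuousAt
  let GB : ℝ →ᵇ ℝ := BoundedContinuousFunction.ofNormedAddCommGroup G Gc 1 hG0
  refine ⟨GB, η, HasUniformDeriv.of_hasDerivAt hG ?_,
    BoundedContinuousFunction.norm_ofNormedAddCommGroup_le Gc zero_le_one hG0, e0, fun x hx => ?_,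
    ei, e1⟩
  · have uc := es.uniformContinuous_of_continuous ec
    rw [Metric.tendsto_nhds]
    intro ε hε
    obtain ⟨δ, hδ, H⟩ := Metric.uniformContinuous_iff.1 uc (ε / 2) (by positivity)
    refine Metric.eventually_nhds_iff.2 ⟨δ, hδ, fun h hh => ?_⟩
    refine lt_of_le_of_lt ((BoundedContinuousFunction.dist_le (C := ε / 2) (by positivity)).2
      fun x => ?_) (by linarith)
    refine (H (a := x + h) (b := x) ?_).le
    simpa [Real.dist_eq] using hh
  · have : x ∉ Function.support e := by
      rw [show Function.support e = Metric.ball x₀ r from b.support_normed_eq]; exact hx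
    exact Function.notMem_support.1 this

/-- If `b² > d` near `x` with `d` above the bound, take a smooth step `G` whose derivative `η` has
mass one there. Then `d ≤ ∫ η b² = -2 ∫ G b b_x ≤ 2 ‖M‖ ‖W‖`, a contradiction. -/
lemma HasStrongDeriv.sq_le {M W : L2R} (hM : HasStrongDeriv M W) {b : ℝ → ℝ} (hb : Continuous b)
    (hbM : b =ᵐ[volume] M) (x : ℝ) : b x ^ 2 ≤ 2 * (‖M‖ * ‖W‖) := by
  by_contra! hlt
  set c := 2 * (‖M‖ * ‖W‖)
  obtain ⟨d, hcd, hd⟩ := exists_between hlt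
  obtain ⟨r, hr, hball⟩ := Metric.eventually_nhds_iff_ball.1
    ((hb.pow 2).continuousAt.eventually_const_lt hd)
  obtain ⟨G, η, hGη, hG1, h0, hsupp, hi, h1⟩ := exists_smooth_step x hr
  have ibp := hM.inner_mulB_add hGη hM
  have e1 : d ≤ ⟪mulB η M, M⟫ := by
    rw [inner_mulB, ← mul_one d, ← h1, ← integral_const_mul]
    refine integral_mono_ae (hi.const_mul d) (integrable_mulB η M M) ?_
    filter_upwards [hbM] with y hy
    rw [← hy]
    by_cases hyb : y ∈ Metric.ball x r
    · have : d < b y ^ 2 := hball y hyb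
      have := h0 y
      nlinarith
    · simp [hsupp y hyb]
  have e2 : |⟪mulB G W, M⟫| ≤ ‖M‖ * ‖W‖ := by
    refine (abs_real_inner_le_norm _ _).trans ?_
    have := norm_mulB_le G W
    nlinarith [norm_nonneg M, norm_nonneg W, norm_nonneg G,
      mul_le_mul_of_nonneg_right hG1 (norm_nonneg W)]
  have e3 : ⟪mulB G M, W⟫ = ⟪mulB G W, M⟫ := by
    rw [inner_mulB_comm, real_inner_comm]
  rw [e3] at ibp
  have := neg_abs_le ⟪mulB G W, M⟫
  linarith

lemma HasStrongDeriv.norm_le {M W : L2R} (hM : HasStrongDeriv M W) {b : ℝ → ℝ} (hb : Continuous b)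
    (hbM : b =ᵐ[volume] M) (x : ℝ) : ‖b x‖ ≤ ‖M‖ + ‖W‖ := by
  have h := hM.sq_le hb hbM x
  refine abs_le_of_sq_le_sq (a := b x) (b := ‖M‖ + ‖W‖) ?_ (by positivity)
  nlinarith [sq_nonneg (‖M‖), sq_nonneg ‖W‖]

/-- The bounded continuous function given by a continuous representative. -/
def HasStrongDeriv.bcf {M W : L2R} (hM : HasStrongDeriv M W) {b : ℝ → ℝ} (hb : Continuous b)
    (hbM : b =ᵐ[volume] M) : ℝ →ᵇ ℝ :=
  BoundedContinuousFunction.ofNormedAddCommGroup b hb (‖M‖ + ‖W‖) (hM.norm_le hb hbM)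

lemma HasStrongDeriv.norm_bcf_le {M W : L2R} (hM : HasStrongDeriv M W) {b : ℝ →ᵇ ℝ}
    (hbM : b =ᵐ[volume] M) : ‖b‖ ≤ ‖M‖ + ‖W‖ :=
  (BoundedContinuousFunction.norm_le (by positivity)).2 (hM.norm_le b.continuous hbM)

lemma HasStrongDeriv.dist_bcf_le {M W N Z : L2R} (hM : HasStrongDeriv M W)
    (hN : HasStrongDeriv N Z) {b c : ℝ →ᵇ ℝ} (hb : b =ᵐ[volume] M) (hc : c =ᵐ[volume] N) :
    dist b c ≤ dist M N + dist W Z := by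
  rw [dist_eq_norm, dist_eq_norm, dist_eq_norm]
  refine (hM.sub hN).norm_bcf_le ?_
  filter_upwards [hb, hc, Lp.coeFn_sub M N] with x h1 h2 h3
  rw [h3]; simp [h1, h2]

/-- Convergence in `H¹` implies uniform convergence. -/
lemma tendsto_bcf {ι : Type*} {l : Filter ι} {M W : ι → L2R} {N Z : L2R} {b : ι → ℝ →ᵇ ℝ}
    {c : ℝ →ᵇ ℝ} (hM : ∀ᶠ i in l, HasStrongDeriv (M i) (W i) ∧ b i =ᵐ[volume] M i)
    (hN : HasStrongDeriv N Z) (hc : c =ᵐ[volume] N)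
    (h1 : Tendsto M l (𝓝 N)) (h2 : Tendsto W l (𝓝 Z)) : Tendsto b l (𝓝 c) := by
  rw [tendsto_iff_dist_tendsto_zero] at *
  refine squeeze_zero' (Eventually.of_forall fun i => dist_nonneg)
    (hM.mono fun i hi => hi.1.dist_bcf_le hN hi.2 hc) ?_
  simpa using h1.add h2

/-- Translations are continuous in `H¹`, hence in the uniform norm by `tendsto_bcf`. -/
lemma HasStrongDeriv.tendsto_bshift {M W : L2R} (hM : HasStrongDeriv M W) {b : ℝ →ᵇ ℝ}
    (hb : b =ᵐ[volume] M) : Tendsto (fun h => bshift h b) (𝓝 0) (𝓝 b) := by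
  have h1 := (continuous_shift M).tendsto 0
  have h2 := (continuous_shift W).tendsto 0
  rw [shift_zero] at h1 h2
  refine tendsto_bcf (Eventually.of_forall fun h => ⟨hM.shifted h, ?_⟩) hM hb h1 h2
  filter_upwards [ae_comp_add hb h, shift_coe h M] with x hx hx'
  rw [hx', bshift_apply, hx]

lemma hasStrongDeriv_iff_tendsto {M W : L2R} : HasStrongDeriv M W ↔
    Tendsto (fun h : ℝ => h⁻¹ • (shift h M - M)) (𝓝[≠] 0) (𝓝 W) := by
  rw [HasStrongDeriv, hasDerivAt_iff_tendsto_slope_zero]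
  simp only [zero_add, shift_zero]

lemma Filter.Tendsto.clm_apply₂ {X Y Z : Type*} [NormedAddCommGroup X] [NormedSpace ℝ X]
    [NormedAddCommGroup Y] [NormedSpace ℝ Y] [NormedAddCommGroup Z] [NormedSpace ℝ Z]
    (L : X →L[ℝ] Y →L[ℝ] Z) {ι : Type*} {l : Filter ι} {b : ι → X} {M : ι → Y} {c : X} {W : Y}
    (hb : Tendsto b l (𝓝 c)) (hM : Tendsto M l (𝓝 W)) :
    Tendsto (fun i => L (b i) (M i)) l (𝓝 (L c W)) :=
  (L.continuous₂.tendsto (c, W)).comp (hb.prodMk_nhds hM)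

/-- The square of an `H¹` function. -/
lemma HasStrongDeriv.mulB_self {M W : L2R} (hM : HasStrongDeriv M W) {b : ℝ →ᵇ ℝ}
    (hb : b =ᵐ[volume] M) : HasStrongDeriv (mulB b M) ((2 : ℝ) • mulB b W) := by
  have hs := hasStrongDeriv_iff_tendsto.1 hM
  refine hasStrongDeriv_iff_tendsto.2 ?_
  have hb' := (hM.tendsto_bshift hb).mono_left (nhdsWithin_le_nhds (s := {0}ᶜ))
  have key : Tendsto (fun h : ℝ => mulB (bshift h b + b) (h⁻¹ • (shift h M - M)))
      (𝓝[≠] 0) (𝓝 (mulB (b + b) W)) :=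
    (hb'.add_const b).clm_apply₂ mulB hs
  rw [← two_smul ℝ b, map_smul, smul_apply] at key
  refine key.congr fun h => ?_
  have e : (bshift h b : ℝ → ℝ) =ᵐ[volume] shift h M := by
    filter_upwards [ae_comp_add hb h, shift_coe h M] with x hx hx'
    rw [hx', bshift_apply, hx]
  -- The cross terms of `(b(· + h) + b)(M(· + h) - M)` cancel, leaving the increment of the square.
  have sw := mulB_swap e hb
  rw [map_smul, shift_mulB, map_add, add_apply, map_sub, map_sub, sw]
  congr 1
  abel

/-! ### Functions of `(u, u_x)` -/

section Coefficients

variable {F G : ℝ × ℝ → ℝ}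

lemma ContDiff.dU (hF : ContDiff ℝ ∞ F) : ContDiff ℝ ∞ (dU F) :=
  (hF.fderiv_right (m := ∞) (by simp)).clm_apply contDiff_const

lemma ContDiff.dUx (hF : ContDiff ℝ ∞ F) : ContDiff ℝ ∞ (dUx F) :=
  (hF.fderiv_right (m := ∞) (by simp)).clm_apply contDiff_const

lemma ContDiff.tilD (hF : ContDiff ℝ ∞ F) : ContDiff ℝ ∞ (tilD F) :=
  (contDiff_snd.mul hF.dU).add (contDiff_fst.mul hF.dUx)

lemma ContDiff.differentiableAt_infty (hF : ContDiff ℝ ∞ F) (p : ℝ × ℝ) :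
    DifferentiableAt ℝ F p := (hF.differentiable (by simp)) p

lemma dU_add (hF : ContDiff ℝ ∞ F) (hG : ContDiff ℝ ∞ G) (p : ℝ × ℝ) :
    dU (fun q => F q + G q) p = dU F p + dU G p := by
  simp [dU, fderiv_fun_add (hF.differentiableAt_infty p) (hG.differentiableAt_infty p)]

lemma dUx_add (hF : ContDiff ℝ ∞ F) (hG : ContDiff ℝ ∞ G) (p : ℝ × ℝ) :
    dUx (fun q => F q + G q) p = dUx F p + dUx G p := by
  simp [dUx, fderiv_fun_add (hF.differentiableAt_infty p) (hG.differentiableAt_infty p)]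

lemma tilD_add (hF : ContDiff ℝ ∞ F) (hG : ContDiff ℝ ∞ G) (p : ℝ × ℝ) :
    tilD (fun q => F q + G q) p = tilD F p + tilD G p := by
  simp only [tilD, dU_add hF hG, dUx_add hF hG]; ring

lemma tilD_sub (hF : ContDiff ℝ ∞ F) (hG : ContDiff ℝ ∞ G) (p : ℝ × ℝ) :
    tilD (fun q => F q - G q) p = tilD F p - tilD G p := by
  simp only [tilD, dU, dUx,
    fderiv_fun_sub (hF.differentiableAt_infty p) (hG.differentiableAt_infty p), sub_apply]
  ring

lemma dU_dUx (hF : ContDiff ℝ ∞ F) (p : ℝ × ℝ) : dU (dUx F) p = dUx (dU F) p := by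
  have hd : DifferentiableAt ℝ (fderiv ℝ F) p :=
    ((hF.fderiv_right (m := ∞) (by simp)).differentiable (by simp)) p
  have hs : IsSymmSndFDerivAt ℝ F p :=
    hF.contDiffAt.isSymmSndFDerivAt (by simpa using ENat.LEInfty.out)
  have e : ∀ v w : ℝ × ℝ, fderiv ℝ (fun q => fderiv ℝ F q v) p w = fderiv ℝ (fderiv ℝ F) p w v :=
    fun v w => by
      rw [fderiv_clm_apply hd (differentiableAt_const v)]
      simp
  change fderiv ℝ (fun q => fderiv ℝ F q (0, 1)) p (1, 0)
    = fderiv ℝ (fun q => fderiv ℝ F q (1, 0)) p (0, 1)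
  rw [e, e]
  exact hs _ _

lemma fderiv_tilD (hF : ContDiff ℝ ∞ F) (p v : ℝ × ℝ) :
    fderiv ℝ (tilD F) p v = p.2 * fderiv ℝ (dU F) p v + v.2 * dU F p
      + (p.1 * fderiv ℝ (dUx F) p v + v.1 * dUx F p) := by
  have h1 := (hF.dU.differentiableAt_infty p).hasFDerivAt
  have h2 := (hF.dUx.differentiableAt_infty p).hasFDerivAt
  have h := ((hasFDerivAt_snd (𝕜 := ℝ) (p := p)).mul h1).add
    ((hasFDerivAt_fst (𝕜 := ℝ) (p := p)).mul h2)
  have e : fderiv ℝ (tilD F) p = _ := h.fderiv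
  rw [e]
  simp [mul_comm]

/-- The commutator `[∂_{u_x}, D̃] = ∂_u`. Together with `[∂_u, D̃] = ∂_{u_x}` it brings iterated
derivatives to a common order. -/
lemma dUx_tilD (hF : ContDiff ℝ ∞ F) (p : ℝ × ℝ) :
    dUx (tilD F) p = dU F p + tilD (dUx F) p := by
  rw [dUx, fderiv_tilD hF]
  have := dU_dUx hF p
  simp only [tilD, this]
  simp only [dUx]
  ring

lemma dU_tilD (hF : ContDiff ℝ ∞ F) (p : ℝ × ℝ) :
    dU (tilD F) p = dUx F p + tilD (dU F) p := by
  rw [dU, fderiv_tilD hF]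
  have := dU_dUx hF p
  simp only [tilD, ← this]
  simp only [dU]
  ring

end Coefficients

/-- The bounded continuous function `x ↦ F (a x, b x)`. -/
def compB (F : ℝ × ℝ → ℝ) (hF : ContDiff ℝ ∞ F) (a b : ℝ →ᵇ ℝ) : ℝ →ᵇ ℝ :=
  BoundedContinuousFunction.mkOfBound
    ⟨fun x => F (a x, b x), hF.continuous.comp (a.continuous.prodMk b.continuous)⟩
    (Metric.diam (F '' (Metric.closedBall 0 (max ‖a‖ ‖b‖))))
    (fun x y => by
      have hb : Bornology.IsBounded (F '' (Metric.closedBall 0 (max ‖a‖ ‖b‖))) :=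
        ((isCompact_closedBall _ _).image hF.continuous).isBounded
      have hm : ∀ z, (a z, b z) ∈ Metric.closedBall (0 : ℝ × ℝ) (max ‖a‖ ‖b‖) := fun z => by
        rw [mem_closedBall_zero_iff, Prod.norm_def]
        exact max_le_max (a.norm_coe_le_norm z) (b.norm_coe_le_norm z)
      exact Metric.dist_le_diam_of_mem hb (mem_image_of_mem _ (hm x)) (mem_image_of_mem _ (hm y)))

@[simp] lemma compB_apply (F : ℝ × ℝ → ℝ) (hF : ContDiff ℝ ∞ F) (a b : ℝ →ᵇ ℝ) (x : ℝ) :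
    compB F hF a b x = F (a x, b x) := rfl

lemma tendsto_compB (F : ℝ × ℝ → ℝ) (hF : ContDiff ℝ ∞ F) {ι : Type*} {l : Filter ι}
    {a b : ι → ℝ →ᵇ ℝ} {a₀ b₀ : ℝ →ᵇ ℝ} (ha : Tendsto a l (𝓝 a₀)) (hb : Tendsto b l (𝓝 b₀)) :
    Tendsto (fun i => compB F hF (a i) (b i)) l (𝓝 (compB F hF a₀ b₀)) := by
  rw [Metric.tendsto_nhds]
  intro ε hε
  -- The extra `1`, matched by `min δ 1` below, keeps nearby functions inside the compact ball on
  -- which `F` is uniformly continuous.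
  set R := max ‖a₀‖ ‖b₀‖ + 1
  have huc := (isCompact_closedBall (0 : ℝ × ℝ) R).uniformContinuousOn_of_continuous
    hF.continuous.continuousOn
  obtain ⟨δ, hδ, H⟩ := Metric.uniformContinuousOn_iff.1 huc (ε / 2) (by positivity)
  filter_upwards [Metric.tendsto_nhds.1 ha (min δ 1) (by positivity),
    Metric.tendsto_nhds.1 hb (min δ 1) (by positivity)] with i h1 h2
  refine lt_of_le_of_lt ((BoundedContinuousFunction.dist_le (C := ε / 2) (by positivity)).2
    fun x => ?_) (by linarith)
  have d1 := (BoundedContinuousFunction.dist_coe_le_dist (f := a i) (g := a₀) x).trans_lt h1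
  have d2 := (BoundedContinuousFunction.dist_coe_le_dist (f := b i) (g := b₀) x).trans_lt h2
  rw [lt_min_iff] at d1 d2
  have n1 := a₀.norm_coe_le_norm x
  have n2 := b₀.norm_coe_le_norm x
  have l1 := le_max_left ‖a₀‖ ‖b₀‖
  have l2 := le_max_right ‖a₀‖ ‖b₀‖
  refine (H _ ?_ _ ?_ ?_).le
  · rw [mem_closedBall_zero_iff, Prod.norm_def]
    have e1 : ‖a i x‖ ≤ dist (a i x) (a₀ x) + ‖a₀ x‖ := by
      rw [dist_eq_norm]; simpa using norm_add_le (a i x - a₀ x) (a₀ x)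
    have e2 : ‖b i x‖ ≤ dist (b i x) (b₀ x) + ‖b₀ x‖ := by
      rw [dist_eq_norm]; simpa using norm_add_le (b i x - b₀ x) (b₀ x)
    exact max_le (by dsimp only; linarith [d1.2]) (by dsimp only; linarith [d2.2])
  · rw [mem_closedBall_zero_iff, Prod.norm_def]
    exact max_le (by dsimp only; linarith) (by dsimp only; linarith)
  · rw [Prod.dist_eq]
    exact max_lt d1.1 d2.1

/-! ### Profiles of a solution at a fixed time -/

/-- An `H³` function `u` with `p = u_x` and `m = u - u_xx`; `M` is the class of `m` in `L²` and
`W` is the class of `m_x`. -/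
structure Profile where
  /-- the function -/
  u : ℝ →ᵇ ℝ
  /-- its derivative -/
  p : ℝ →ᵇ ℝ
  /-- its momentum -/
  m : ℝ →ᵇ ℝ
  /-- the class of the momentum -/
  M : L2R
  /-- the class of the derivative of the momentum -/
  W : L2R
  deriv_u : ∀ x, HasDerivAt u (p x) x
  deriv_p : ∀ x, HasDerivAt p (u x - m x) x
  ae_eq_M : m =ᵐ[volume] M
  strong : HasStrongDeriv M W
  tendsto_u : Tendsto (fun h => bshift h u) (𝓝 0) (𝓝 u)
  tendsto_p : Tendsto (fun h => bshift h p) (𝓝 0) (𝓝 p)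

namespace Profile

variable (P : Profile)

/-- The function `F(u, u_x)`. -/
def comp (F : ℝ × ℝ → ℝ) (hF : ContDiff ℝ ∞ F) : ℝ →ᵇ ℝ := compB F hF P.u P.p

@[simp] lemma comp_apply (F : ℝ × ℝ → ℝ) (hF : ContDiff ℝ ∞ F) (x : ℝ) :
    P.comp F hF x = F (P.u x, P.p x) := rfl

/-- The `x`-derivative of `F(u, u_x)`. -/
def dcomp (F : ℝ × ℝ → ℝ) (hF : ContDiff ℝ ∞ F) : ℝ →ᵇ ℝ :=
  P.comp (tilD F) hF.tilD - P.comp (dUx F) hF.dUx * P.m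

lemma tendsto_bshift_dcomp (F : ℝ × ℝ → ℝ) (hF : ContDiff ℝ ∞ F) :
    Tendsto (fun h => bshift h (P.dcomp F hF)) (𝓝 0) (𝓝 (P.dcomp F hF)) := by
  have hm := P.strong.tendsto_bshift P.ae_eq_M
  have h1 := tendsto_compB (tilD F) hF.tilD P.tendsto_u P.tendsto_p
  have h2 := tendsto_compB (dUx F) hF.dUx P.tendsto_u P.tendsto_p
  refine (h1.sub (h2.mul hm)).congr fun h => ?_
  simp only [dcomp, map_sub, bshift_mul]
  rfl

/-- The chain rule with `u_xx = u - m`: the part `u_x F_u + u F_{u_x}` is `D̃F`, and the rest is `-m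
F_{u_x}`. -/
lemma hasUniformDeriv_comp (F : ℝ × ℝ → ℝ) (hF : ContDiff ℝ ∞ F) :
    HasUniformDeriv (P.comp F hF) (P.dcomp F hF) := by
  refine HasUniformDeriv.of_hasDerivAt (fun x => ?_) (P.tendsto_bshift_dcomp F hF)
  have h1 := (hF.differentiableAt_infty (P.u x, P.p x)).hasFDerivAt.comp_hasDerivAt x
    ((P.deriv_u x).prodMk (P.deriv_p x))
  refine h1.congr_deriv ?_
  have e : ((P.p x, P.u x - P.m x) : ℝ × ℝ)
      = P.p x • ((1, 0) : ℝ × ℝ) + (P.u x - P.m x) • ((0, 1) : ℝ × ℝ) := by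
    ext <;> simp
  rw [e, map_add, map_smul, map_smul]
  simp [dcomp, tilD, dU, dUx]
  ring

/-- The form `∫ a m²`. -/
def formMM (a : ℝ →ᵇ ℝ) : ℝ := ⟪mulB a P.M, P.M⟫

/-- The form `∫ a m m_x`. -/
def formMW (a : ℝ →ᵇ ℝ) : ℝ := ⟪mulB a P.M, P.W⟫

/-- The form `∫ a m_x²`. -/
def formWW (a : ℝ →ᵇ ℝ) : ℝ := ⟪mulB a P.W, P.W⟫

lemma mulB_m_comm (a : ℝ →ᵇ ℝ) (X : L2R) : mulB a (mulB P.m X) = mulB (a * P.m) X :=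
  (mulB_mul _ _ _).symm

section IntegrationByParts

variable {P} {a a' : ℝ →ᵇ ℝ}

/-- This and the next two lemmas integrate `a (m²)_x`, `a (m³)_x` and `a (m⁴)_x` by parts, whence
the factors 2, 3, 4. The higher powers are split as `m² · m` and `m² · m²`, with `m²` in `H¹` by
`mulB_self`. -/
lemma formMM_add_formMW (ha : HasUniformDeriv a a') :
    P.formMM a' + 2 * P.formMW a = 0 := by
  have h := P.strong.inner_mulB_add ha P.strong
  have e : ⟪mulB a P.W, P.M⟫ = P.formMW a := by
    rw [inner_mulB_comm, real_inner_comm]; rfl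
  rw [e] at h
  simp only [formMM, formMW] at *
  linarith

lemma formMM_m_add_formMW (ha : HasUniformDeriv a a') :
    P.formMM (a' * P.m) + 3 * P.formMW (a * P.m) = 0 := by
  have h := (P.strong.mulB_self P.ae_eq_M).inner_mulB_add ha P.strong
  rw [map_smul, inner_smul_left, mulB_m_comm, mulB_m_comm, mulB_m_comm] at h
  have e : ⟪mulB (a * P.m) P.W, P.M⟫ = P.formMW (a * P.m) := by
    rw [inner_mulB_comm, real_inner_comm]; rfl
  rw [e] at h
  simp only [formMM, formMW, conj_trivial] at *
  linarith

lemma formMM_sq_add_formMW (ha : HasUniformDeriv a a') :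
    P.formMM (a' * P.m ^ 2) + 4 * P.formMW (a * P.m ^ 2) = 0 := by
  have hs := P.strong.mulB_self P.ae_eq_M
  have h := hs.inner_mulB_add ha hs
  rw [map_smul, inner_smul_left, inner_smul_right, mulB_m_comm, mulB_m_comm, mulB_m_comm,
    ← inner_mulB_comm, ← inner_mulB_comm, ← inner_mulB_comm, ← mulB_mul, ← mulB_mul,
    ← mulB_mul] at h
  have e : ∀ c : ℝ →ᵇ ℝ, P.m * (c * P.m) = c * P.m ^ 2 := fun c => by ring
  have e' : ⟪mulB (a * P.m ^ 2) P.W, P.M⟫ = P.formMW (a * P.m ^ 2) := by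
    rw [inner_mulB_comm, real_inner_comm]; rfl
  rw [e, e, e'] at h
  simp only [formMM, formMW, conj_trivial] at *
  linarith

end IntegrationByParts

/-! ### Linearity of the quadratic forms in the coefficient -/

lemma formMM_sub (a b : ℝ →ᵇ ℝ) : P.formMM (a - b) = P.formMM a - P.formMM b := by
  simp [formMM, inner_sub_left]

lemma formMM_add (a b : ℝ →ᵇ ℝ) : P.formMM (a + b) = P.formMM a + P.formMM b := by
  simp [formMM, inner_add_left]

lemma formMM_smul (c : ℝ) (a : ℝ →ᵇ ℝ) : P.formMM (c • a) = c * P.formMM a := by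
  simp [formMM, inner_smul_left]

lemma formMW_sub (a b : ℝ →ᵇ ℝ) : P.formMW (a - b) = P.formMW a - P.formMW b := by
  simp [formMW, inner_sub_left]

lemma formMW_add (a b : ℝ →ᵇ ℝ) : P.formMW (a + b) = P.formMW a + P.formMW b := by
  simp [formMW, inner_add_left]

lemma formWW_sub (a b : ℝ →ᵇ ℝ) : P.formWW (a - b) = P.formWW a - P.formWW b := by
  simp [formWW, inner_sub_left]

lemma formWW_add (a b : ℝ →ᵇ ℝ) : P.formWW (a + b) = P.formWW a + P.formWW b := by
  simp [formWW, inner_add_left]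

lemma formWW_smul (c : ℝ) (a : ℝ →ᵇ ℝ) : P.formWW (c • a) = c * P.formWW a := by
  simp [formWW, inner_smul_left]

end Profile

/-! ### The energy balance at a fixed time -/

section CoefficientSmoothness

variable {f g : ℝ × ℝ → ℝ}

lemma ContDiff.coeffA0 (hf : ContDiff ℝ ∞ f) (hg : ContDiff ℝ ∞ g) :
    ContDiff ℝ ∞ (coeffA0 f g) :=
  ((contDiff_const.mul hf).sub hf.tilD.tilD).add (hg.sub hg.tilD.tilD).tilD

lemma ContDiff.coeffA1 (hf : ContDiff ℝ ∞ f) (hg : ContDiff ℝ ∞ g) :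
    ContDiff ℝ ∞ (coeffA1 f g) :=
  ((hf.dU.add (contDiff_const.mul hf.dUx.tilD)).add (contDiff_const.mul hg.dU.tilD)).add
    (contDiff_const.mul hg.dUx.tilD.tilD)

lemma ContDiff.coeffA2 (hf : ContDiff ℝ ∞ f) (hg : ContDiff ℝ ∞ g) :
    ContDiff ℝ ∞ (coeffA2 f g) :=
  ((contDiff_const.mul hf.dUx.dUx).sub (contDiff_const.mul hg.dU.dUx)).sub
    (contDiff_const.mul hg.dUx.dUx.tilD)

lemma ContDiff.coeffA3 (hg : ContDiff ℝ ∞ g) : ContDiff ℝ ∞ (coeffA3 g) :=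
  contDiff_const.mul hg.dUx.dUx.dUx

lemma ContDiff.coeffB0 (hf : ContDiff ℝ ∞ f) (hg : ContDiff ℝ ∞ g) :
    ContDiff ℝ ∞ (coeffB0 f g) :=
  (contDiff_const.mul hf).add (contDiff_const.mul hg.tilD)

lemma ContDiff.coeffB1 (hg : ContDiff ℝ ∞ g) : ContDiff ℝ ∞ (coeffB1 g) :=
  contDiff_const.mul hg.dUx

lemma ContDiff.add_tilD (hf : ContDiff ℝ ∞ f) (hg : ContDiff ℝ ∞ g) :
    ContDiff ℝ ∞ (fun q => f q + _root_.tilD g q) := hf.add hg.tilD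

end CoefficientSmoothness

/-- The difference quotient `M ↦ (M (· + h) - M) / h`. -/
def diffQuot (h : ℝ) : L2R →L[ℝ] L2R :=
  h⁻¹ • ((shift h).toContinuousLinearMap - ContinuousLinearMap.id ℝ L2R)

lemma diffQuot_apply (h : ℝ) (M : L2R) : diffQuot h M = h⁻¹ • (shift h M - M) := by
  simp [diffQuot]

lemma HasStrongDeriv.tendsto_diffQuot {M W : L2R} (hM : HasStrongDeriv M W) :
    Tendsto (fun h => diffQuot h M) (𝓝[≠] 0) (𝓝 W) := by
  simpa only [diffQuot_apply] using hasStrongDeriv_iff_tendsto.1 hM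

lemma norm_inv_smul_le {X : Type*} [NormedAddCommGroup X] [NormedSpace ℝ X] {x : X}
    {h c : ℝ} (hc : 0 ≤ c) (hx : ‖x‖ ≤ c * |h|) : ‖h⁻¹ • x‖ ≤ c := by
  rcases eq_or_ne h 0 with rfl | h0
  · simpa using hc
  · rw [norm_smul, norm_inv, Real.norm_eq_abs, inv_mul_le_iff₀ (abs_pos.2 h0), mul_comm]
    exact hx

lemma HasStrongDeriv.norm_diffQuot_le {M W : L2R} (hM : HasStrongDeriv M W) (h : ℝ) :
    ‖diffQuot h M‖ ≤ ‖W‖ := by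
  rw [diffQuot_apply]
  exact norm_inv_smul_le (norm_nonneg _) (hM.norm_shift_sub_le h)

lemma HasStrongDeriv.diffQuot {M W : L2R} (hM : HasStrongDeriv M W) (h : ℝ) :
    HasStrongDeriv (diffQuot h M) (diffQuot h W) := by
  rw [diffQuot_apply, diffQuot_apply]
  exact ((hM.shifted h).sub hM).smul h⁻¹

/-- Discrete Leibniz rule, with the translation placed on the coefficient of the top-order term. -/
lemma diffQuot_mulB (h : ℝ) (a : ℝ →ᵇ ℝ) (W : L2R) :
    diffQuot h (mulB a W) = mulB (bshift h a) (diffQuot h W) + mulB (h⁻¹ • (bshift h a - a)) W := by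
  rw [diffQuot_apply, diffQuot_apply, map_smul, map_smul, smul_apply, ← smul_add, shift_mulB, map_sub,
    map_sub, sub_apply]
  congr 1
  abel

namespace Profile

variable (P : Profile) {f g : ℝ × ℝ → ℝ} (hf : ContDiff ℝ ∞ f) (hg : ContDiff ℝ ∞ g)

/-- The coefficient `A` along a profile. -/
def coefA : ℝ →ᵇ ℝ :=
  P.comp _ (hf.coeffA0 hg) + P.comp _ (hf.coeffA1 hg) * P.m + P.comp _ (hf.coeffA2 hg) * P.m ^ 2
    + P.comp _ hg.coeffA3 * P.m ^ 3

/-- The coefficient `B` along a profile. -/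
def coefB : ℝ →ᵇ ℝ := P.comp _ (hf.coeffB0 hg) + P.comp _ hg.coeffB1 * P.m

/-- The integral `∫ (A m² + B m_x²)`. -/
def dissipation : ℝ := P.formMM (P.coefA hf hg) + P.formWW (P.coefB hf hg)

/-- The part `f m + g(u, u_x)_x m` of the equation that lies in `H¹`. -/
def source : L2R :=
  mulB (P.comp _ (hf.add_tilD hg)) P.M - mulB (P.comp _ hg.dUx) (mulB P.m P.M)

/-- The derivative of `Profile.source`. -/
def dsource : L2R :=
  (mulB (P.dcomp _ (hf.add_tilD hg)) P.M + mulB (P.comp _ (hf.add_tilD hg)) P.W)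
    - (mulB (P.dcomp _ hg.dUx) (mulB P.m P.M)
      + mulB (P.comp _ hg.dUx) ((2 : ℝ) • mulB P.m P.W))

lemma hasStrongDeriv_source : HasStrongDeriv (P.source hf hg) (P.dsource hf hg) :=
  (P.strong.bcf_mul (P.hasUniformDeriv_comp _ (hf.add_tilD hg))).sub
    ((P.strong.mulB_self P.ae_eq_M).bcf_mul (P.hasUniformDeriv_comp _ hg.dUx))

/-- The time derivative of the momentum. -/
def momentumRate : L2R := -(P.source hf hg + mulB (P.comp g hg) P.W)

/-- The product rule gives the `L²` derivative of `g m`; uniqueness of that derivative then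
determines `m_t`. -/
lemma eq_momentumRate {Mt : L2R}
    (h : HasWeakDeriv (fun x => g (P.u x, P.p x) * P.m x)
      (fun x => -(Mt x + f (P.u x, P.p x) * P.m x))) : Mt = P.momentumRate hf hg := by
  have h1 : HasWeakDeriv (mulB (P.comp g hg) P.M) (-(Mt + mulB (P.comp f hf) P.M) : L2R) := by
    refine h.congr ?_ ?_
    · filter_upwards [mulB_coe (P.comp g hg) P.M, P.ae_eq_M] with x h1 h2
      rw [h1, h2]; rfl
    · filter_upwards [mulB_coe (P.comp f hf) P.M, P.ae_eq_M,
        Lp.coeFn_neg (Mt + mulB (P.comp f hf) P.M),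
        Lp.coeFn_add Mt (mulB (P.comp f hf) P.M)] with x h1 h2 h3 h4
      rw [h3, Pi.neg_apply, h4, Pi.add_apply, h1, h2]; rfl
  have h2 := h1.hasStrongDeriv.unique (P.strong.bcf_mul (P.hasUniformDeriv_comp g hg))
  have h3 : Mt = -(mulB (P.dcomp g hg) P.M + mulB (P.comp g hg) P.W)
      - mulB (P.comp f hf) P.M := by
    rw [← h2]; abel
  have h4 : P.comp _ (hf.add_tilD hg) = P.comp f hf + P.comp _ hg.tilD := by ext; simp
  rw [h3, momentumRate, source, h4, dcomp, map_sub, map_add, add_apply, sub_apply, mulB_mul]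
  abel

lemma two_inner_momentumRate :
    2 * ⟪P.M, P.momentumRate hf hg⟫
      = -2 * ⟪P.M, P.source hf hg⟫ + P.formMM (P.dcomp g hg) := by
  have h := formMM_add_formMW (P := P) (P.hasUniformDeriv_comp g hg)
  have e : ⟪P.M, mulB (P.comp g hg) P.W⟫ = P.formMW (P.comp g hg) := (inner_mulB_comm _ _ _).symm
  rw [momentumRate, inner_neg_right, inner_add_right, e]
  linarith

/-- The algebraic identity behind the energy balance. -/
lemma energy_identity :
    -2 * ⟪P.W, P.dsource hf hg⟫ - P.formWW (P.dcomp g hg) - 2 * ⟪P.M, P.source hf hg⟫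
      + P.formMM (P.dcomp g hg) = -P.dissipation hf hg := by
  set k : ℝ × ℝ → ℝ := fun q => f q + tilD g q with hkdef
  have hk : ContDiff ℝ ∞ k := hf.add_tilD hg
  -- With `k = f + D̃g`, the coefficient of `m m_x` is `D̃k - (k_{u_x} + D̃g_{u_x}) m + g_{u_x u_x}
  -- m²`. Each of `i1`, `i2`, `i3` integrates one power of `m` by parts.
  have hl : ContDiff ℝ ∞ (fun q => dUx k q + tilD (dUx g) q) := hk.dUx.add_tilD hg.dUx
  have i1 := formMM_add_formMW (P := P) (P.hasUniformDeriv_comp _ hk.tilD)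
  have i2 := formMM_m_add_formMW (P := P) (P.hasUniformDeriv_comp _ hl)
  have i3 := formMM_sq_add_formMW (P := P) (P.hasUniformDeriv_comp _ hg.dUx.dUx)
  have eS : ⟪P.M, P.source hf hg⟫
      = P.formMM (P.comp k hk) - P.formMM (P.comp _ hg.dUx * P.m) := by
    rw [source, real_inner_comm, inner_sub_left, ← mulB_mul]; rfl
  have eD : ⟪P.W, P.dsource hf hg⟫
      = P.formMW (P.dcomp k hk) + P.formWW (P.comp k hk) - (P.formMW (P.dcomp _ hg.dUx * P.m)
        + 2 * P.formWW (P.comp _ hg.dUx * P.m)) := by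
    rw [dsource, real_inner_comm, inner_sub_left, inner_add_left, inner_add_left, map_smul,
      inner_smul_left, ← mulB_mul, ← mulB_mul]; rfl
  have eMW : P.formMW (P.dcomp k hk) - P.formMW (P.dcomp _ hg.dUx * P.m)
      = P.formMW (P.comp _ hk.tilD) - P.formMW (P.comp _ hl * P.m)
        + P.formMW (P.comp _ hg.dUx.dUx * P.m ^ 2) := by
    rw [← formMW_sub, ← formMW_sub, ← formMW_add]
    congr 1
    ext x
    simp [dcomp]
    ring
  have eWW : P.formWW (P.coefB hf hg) = 2 * P.formWW (P.comp k hk)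
      - 4 * P.formWW (P.comp _ hg.dUx * P.m) + P.formWW (P.dcomp g hg) := by
    rw [← formWW_smul, ← formWW_smul, ← formWW_sub, ← formWW_add]
    congr 1
    ext x
    simp [dcomp, coefB, coeffB0, coeffB1, k]
    ring
  have eMM : P.formMM (P.coefA hf hg) = 2 * P.formMM (P.comp k hk)
      - 2 * P.formMM (P.comp _ hg.dUx * P.m) - P.formMM (P.dcomp g hg)
      - P.formMM (P.dcomp _ hk.tilD) + 2 / 3 * P.formMM (P.dcomp _ hl * P.m)
      - 1 / 2 * P.formMM (P.dcomp _ hg.dUx.dUx * P.m ^ 2) := by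
    rw [← formMM_smul, ← formMM_smul, ← formMM_smul, ← formMM_smul, ← formMM_sub, ← formMM_sub,
      ← formMM_sub, ← formMM_add, ← formMM_sub]
    congr 1
    ext x
    -- Commuting `D̃` past the partial derivatives expresses both sides in the same derivatives of
    -- `f` and `g`, so that a polynomial identity remains.
    have c1 : dUx k = fun q => dUx f q + (dU g q + tilD (dUx g) q) := by
      funext q; rw [hkdef, dUx_add hf hg.tilD, dUx_tilD hg]
    have c2 : dU k = fun q => dU f q + (dUx g q + tilD (dU g) q) := by
      funext q; rw [hkdef, dU_add hf hg.tilD, dU_tilD hg]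
    have c3 : tilD k = fun q => tilD f q + tilD (tilD g) q := by
      funext q; rw [hkdef, tilD_add hf hg.tilD]
    have hq := hg.dU.add_tilD hg.dUx
    simp only [dcomp, coefA, coeffA0, coeffA1, coeffA2, coeffA3, BoundedContinuousFunction.coe_add,
      BoundedContinuousFunction.coe_sub, BoundedContinuousFunction.coe_mul,
      BoundedContinuousFunction.coe_smul, BoundedContinuousFunction.coe_pow, Pi.add_apply,
      Pi.sub_apply, Pi.mul_apply, Pi.pow_apply, smul_eq_mul, comp_apply]
    generalize (P.u x, P.p x) = q
    rw [tilD_sub hg hg.tilD.tilD, dUx_tilD hk, c3, tilD_add hf.tilD hg.tilD.tilD,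
      tilD_add hk.dUx hg.dUx.tilD, dUx_add hk.dUx hg.dUx.tilD, c1, c2, tilD_add hf.dUx hq,
      tilD_add hg.dU hg.dUx.tilD, dUx_add hf.dUx hq, dUx_add hg.dU hg.dUx.tilD,
      dUx_tilD hg.dUx, dU_dUx hg]
    simp only [k]
    ring
  rw [dissipation, eS, eD, eWW, eMM]
  linarith

/-- The rate of change of the square of the difference quotient of the momentum. -/
lemma two_inner_diffQuot (h : ℝ) :
    2 * ⟪diffQuot h P.M, diffQuot h (P.momentumRate hf hg)⟫
      = -2 * ⟪diffQuot h P.M, diffQuot h (P.source hf hg)⟫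
        + ⟪mulB (bshift h (P.dcomp g hg)) (diffQuot h P.M), diffQuot h P.M⟫
        - 2 * ⟪diffQuot h P.M, mulB (h⁻¹ • (bshift h (P.comp g hg) - P.comp g hg)) P.W⟫ := by
  have hs := P.strong.diffQuot h
  -- The term with `D_h m_x` has no bound uniform in `h`; by parts it becomes quadratic in `D_h m`.
  have ibp := hs.inner_mulB_add ((P.hasUniformDeriv_comp g hg).bshifted h) hs
  have e : ⟪mulB (bshift h (P.comp g hg)) (diffQuot h P.W), diffQuot h P.M⟫
      = ⟪diffQuot h P.M, mulB (bshift h (P.comp g hg)) (diffQuot h P.W)⟫ := real_inner_comm _ _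
  rw [inner_mulB_comm _ (diffQuot h P.M) (diffQuot h P.W), e] at ibp
  rw [momentumRate, map_neg, map_add, diffQuot_mulB, inner_neg_right, inner_add_right, inner_add_right]
  linarith

/-- The integration by parts contributes `∫ g_x m_x²` and the Leibniz remainder `-2 ∫ g_x m_x²`, so
`-∫ g_x m_x²` survives. -/
lemma tendsto_two_inner_diffQuot :
    Tendsto (fun h => 2 * ⟪diffQuot h P.M, diffQuot h (P.momentumRate hf hg)⟫) (𝓝[≠] 0)
      (𝓝 (-2 * ⟪P.W, P.dsource hf hg⟫ - P.formWW (P.dcomp g hg))) := by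
  simp only [two_inner_diffQuot]
  have hM := P.strong.tendsto_diffQuot
  have hS := (P.hasStrongDeriv_source hf hg).tendsto_diffQuot
  have hg' := P.hasUniformDeriv_comp g hg
  have hd : Tendsto (fun h : ℝ => h⁻¹ • (bshift h (P.comp g hg) - P.comp g hg)) (𝓝[≠] 0)
      (𝓝 (P.dcomp g hg)) := by
    have := hasDerivAt_iff_tendsto_slope_zero.1 hg'
    simpa only [zero_add, bshift_zero] using this
  have hb : Tendsto (fun h => bshift h (P.dcomp g hg)) (𝓝[≠] 0) (𝓝 (P.dcomp g hg)) :=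
    (P.tendsto_bshift_dcomp g hg).mono_left nhdsWithin_le_nhds
  have h1 := (hM.inner (𝕜 := ℝ) hS).const_mul (-2)
  have h2 := (hb.clm_apply₂ mulB hM).inner (𝕜 := ℝ) hM
  have h3 := (hM.inner (𝕜 := ℝ) (hd.clm_apply₂ mulB (tendsto_const_nhds (x := P.W)))).const_mul 2
  convert (h1.add h2).sub h3 using 2
  rw [formWW, real_inner_comm (mulB _ _)]
  ring

/-- Every difference quotient is bounded by the norm of its limit, so the bound is free of `h` and
can serve as the dominating function. -/
lemma abs_two_inner_diffQuot_le (h : ℝ) :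
    |2 * ⟪diffQuot h P.M, diffQuot h (P.momentumRate hf hg)⟫|
      ≤ 2 * (‖P.W‖ * ‖P.dsource hf hg‖) + 3 * (‖P.dcomp g hg‖ * ‖P.W‖ ^ 2) := by
  rw [two_inner_diffQuot]
  have hM := P.strong.norm_diffQuot_le h
  have hS := (P.hasStrongDeriv_source hf hg).norm_diffQuot_le h
  have hd : ‖h⁻¹ • (bshift h (P.comp g hg) - P.comp g hg)‖ ≤ ‖P.dcomp g hg‖ :=
    norm_inv_smul_le (norm_nonneg _) ((P.hasUniformDeriv_comp g hg).norm_bshift_sub_le h)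
  have b1 : |⟪diffQuot h P.M, diffQuot h (P.source hf hg)⟫| ≤ ‖P.W‖ * ‖P.dsource hf hg‖ :=
    (abs_real_inner_le_norm _ _).trans (by gcongr)
  have b2 : |⟪mulB (bshift h (P.dcomp g hg)) (diffQuot h P.M), diffQuot h P.M⟫|
      ≤ ‖P.dcomp g hg‖ * ‖P.W‖ * ‖P.W‖ := by
    refine (abs_real_inner_le_norm _ _).trans ?_
    have := norm_mulB_le (bshift h (P.dcomp g hg)) (diffQuot h P.M)
    rw [LinearIsometry.norm_map] at this
    gcongr
    exact this.trans (by gcongr)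
  have b3 : |⟪diffQuot h P.M, mulB (h⁻¹ • (bshift h (P.comp g hg) - P.comp g hg)) P.W⟫|
      ≤ ‖P.W‖ * (‖P.dcomp g hg‖ * ‖P.W‖) := by
    refine (abs_real_inner_le_norm _ _).trans ?_
    gcongr
    exact (norm_mulB_le _ _).trans (by gcongr)
  rw [abs_le] at *
  constructor <;> nlinarith

end Profile

/-! ### The energy balance in time -/

lemma hasDerivWithinAt_of_eq_integral {T : ℝ} {E ψ : ℝ → ℝ} (hψ : ContinuousOn ψ (Ico 0 T))
    (hE : ∀ t ∈ Ico 0 T, E t - E 0 = ∫ s in (0 : ℝ)..t, ψ s) {t : ℝ} (ht : t ∈ Ico 0 T) :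
    HasDerivWithinAt E (ψ t) (Ico 0 T) t := by
  obtain ⟨b, htb, hbT⟩ := exists_between ht.2
  have h0b : (0 : ℝ) ≤ b := ht.1.trans htb.le
  have hsub : Icc 0 b ⊆ Ico 0 T := fun s hs => ⟨hs.1, hs.2.trans_lt hbT⟩
  -- Extending `ψ` by constants beyond `[0, b]` gives a continuous integrand on the line, which also
  -- covers the one-sided derivative at `0`.
  let χ : ℝ → ℝ := IccExtend h0b ((Icc 0 b).domRestrict ψ)
  have hχ : Continuous χ := (continuousOn_iff_continuous_domRestrict.1 (hψ.mono hsub)).Icc_extend'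
  have hχe : ∀ s ∈ Icc 0 b, χ s = ψ s := fun s hs => IccExtend_of_mem h0b _ hs
  have hd := ((hχ.integral_hasStrictDerivAt 0 t).hasDerivAt.const_add (E 0)).hasDerivWithinAt
    (s := Icc 0 b)
  rw [hχe t ⟨ht.1, htb.le⟩] at hd
  have heq : ∀ s ∈ Icc 0 b, E s = E 0 + ∫ r in (0 : ℝ)..s, χ r := fun s hs => by
    rw [← sub_eq_iff_eq_add', hE s (hsub hs)]
    refine intervalIntegral.integral_congr fun r hr => ?_
    rw [uIcc_of_le hs.1] at hr
    exact (hχe r ⟨hr.1, hr.2.trans hs.2⟩).symm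
  refine (hd.congr heq (heq t ⟨ht.1, htb.le⟩)).mono_of_mem_nhdsWithin ?_
  filter_upwards [self_mem_nhdsWithin, mem_nhdsWithin_of_mem_nhds (Iic_mem_nhds htb)] with s h1 h2
  exact ⟨h1.1, h2⟩

lemma ContinuousOn.clm_apply₂ {X Y Z : Type*} [NormedAddCommGroup X] [NormedSpace ℝ X]
    [NormedAddCommGroup Y] [NormedSpace ℝ Y] [NormedAddCommGroup Z] [NormedSpace ℝ Z]
    (L : X →L[ℝ] Y →L[ℝ] Z) {S : Set ℝ} {b : ℝ → X} {M : ℝ → Y}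
    (hb : ContinuousOn b S) (hM : ContinuousOn M S) : ContinuousOn (fun t => L (b t) (M t)) S :=
  fun t ht => Filter.Tendsto.clm_apply₂ L (hb t ht) (hM t ht)

/-- A curve of profiles that is continuous in `H³`. -/
structure ContinuousProfileOn (P : ℝ → Profile) (S : Set ℝ) : Prop where
  u : ContinuousOn (fun t => (P t).u) S
  p : ContinuousOn (fun t => (P t).p) S
  m : ContinuousOn (fun t => (P t).m) S
  M : ContinuousOn (fun t => (P t).M) S
  W : ContinuousOn (fun t => (P t).W) S

namespace ContinuousProfileOn

variable {P : ℝ → Profile} {S : Set ℝ}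
  {f g : ℝ × ℝ → ℝ} (hf : ContDiff ℝ ∞ f) (hg : ContDiff ℝ ∞ g)

lemma comp (hP : ContinuousProfileOn P S) {F : ℝ × ℝ → ℝ} (hF : ContDiff ℝ ∞ F) :
    ContinuousOn (fun t => (P t).comp F hF) S :=
  fun t ht => tendsto_compB F hF (hP.u t ht) (hP.p t ht)

lemma dcomp (hP : ContinuousProfileOn P S) {F : ℝ × ℝ → ℝ} (hF : ContDiff ℝ ∞ F) :
    ContinuousOn (fun t => (P t).dcomp F hF) S :=
  (hP.comp hF.tilD).sub ((hP.comp hF.dUx).mul hP.m)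

lemma source (hP : ContinuousProfileOn P S) : ContinuousOn (fun t => (P t).source hf hg) S :=
  ((hP.comp (hf.add_tilD hg)).clm_apply₂ mulB hP.M).sub
    ((hP.comp hg.dUx).clm_apply₂ mulB (hP.m.clm_apply₂ mulB hP.M))

lemma dsource (hP : ContinuousProfileOn P S) : ContinuousOn (fun t => (P t).dsource hf hg) S :=
  (((hP.dcomp (hf.add_tilD hg)).clm_apply₂ mulB hP.M).add
    ((hP.comp (hf.add_tilD hg)).clm_apply₂ mulB hP.W)).sub
    (((hP.dcomp hg.dUx).clm_apply₂ mulB (hP.m.clm_apply₂ mulB hP.M)).add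
      ((hP.comp hg.dUx).clm_apply₂ mulB ((hP.m.clm_apply₂ mulB hP.W).const_smul (2 : ℝ))))

lemma momentumRate (hP : ContinuousProfileOn P S) :
    ContinuousOn (fun t => (P t).momentumRate hf hg) S :=
  ((hP.source hf hg).add ((hP.comp hg).clm_apply₂ mulB hP.W)).neg

/-- The balance of `∫ m_x²`, in integrated form. -/
lemma norm_sq_sub_eq_integral {T : ℝ} (hP : ContinuousProfileOn P (Ico 0 T))
    (hd : ∀ t ∈ Ico 0 T,
      HasDerivWithinAt (fun s => (P s).M) ((P t).momentumRate hf hg) (Ico 0 T) t)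
    {t : ℝ} (ht : t ∈ Ico 0 T) :
    ‖(P t).W‖ ^ 2 - ‖(P 0).W‖ ^ 2 = ∫ s in (0 : ℝ)..t,
      (-2 * ⟪(P s).W, (P s).dsource hf hg⟫ - (P s).formWW ((P s).dcomp g hg)) := by
  have hsub : Icc 0 t ⊆ Ico 0 T := fun s hs => ⟨hs.1, hs.2.trans_lt ht.2⟩
  have hu : uIcc 0 t = Icc 0 t := uIcc_of_le ht.1
  have hqc : ∀ h : ℝ, ContinuousOn (fun s => 2 * ⟪diffQuot h (P s).M,
      diffQuot h ((P s).momentumRate hf hg)⟫) (uIcc 0 t) := fun h => by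
    rw [hu]
    refine ContinuousOn.mono (continuousOn_const.mul (ContinuousOn.inner ?_ ?_)) hsub
    · exact (diffQuot h).continuous.comp_continuousOn hP.M
    · exact (diffQuot h).continuous.comp_continuousOn (hP.momentumRate hf hg)
  -- For fixed `h` the operator `D_h` is bounded on `L²`, so `‖D_h m‖²` is differentiable in time
  -- because `m` is.
  have ftc : ∀ h : ℝ, ∫ s in (0 : ℝ)..t, 2 * ⟪diffQuot h (P s).M, diffQuot h ((P s).momentumRate hf hg)⟫
      = ‖diffQuot h (P t).M‖ ^ 2 - ‖diffQuot h (P 0).M‖ ^ 2 := fun h => by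
    refine intervalIntegral.integral_eq_sub_of_hasDerivAt_of_le ht.1
      (f := fun s => ‖diffQuot h (P s).M‖ ^ 2) ?_ (fun s hs => ?_) (hqc h).intervalIntegrable
    · exact (((diffQuot h).continuous.comp_continuousOn (hP.M.mono hsub)).norm).pow 2
    · have hs' : s ∈ Ico 0 T := ⟨hs.1.le, hs.2.trans ht.2⟩
      have h1 : HasDerivAt (fun s => (P s).M) ((P s).momentumRate hf hg) s :=
        (hd s hs').hasDerivAt (Ico_mem_nhds hs.1 hs'.2)
      exact ((diffQuot h).hasFDerivAt.comp_hasDerivAt s h1).norm_sq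
  have hlim : Tendsto (fun h => ‖diffQuot h (P t).M‖ ^ 2 - ‖diffQuot h (P 0).M‖ ^ 2) (𝓝[≠] 0)
      (𝓝 (‖(P t).W‖ ^ 2 - ‖(P 0).W‖ ^ 2)) :=
    ((P t).strong.tendsto_diffQuot.norm.pow 2).sub ((P 0).strong.tendsto_diffQuot.norm.pow 2)
  simp only [← ftc] at hlim
  refine tendsto_nhds_unique hlim
    (intervalIntegral.tendsto_integral_filter_of_dominated_convergence
      (fun s => 2 * (‖(P s).W‖ * ‖(P s).dsource hf hg‖)
        + 3 * (‖(P s).dcomp g hg‖ * ‖(P s).W‖ ^ 2)) ?_ ?_ ?_ ?_)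
  · refine Eventually.of_forall fun h => ?_
    exact ((hqc h).mono uIoc_subset_uIcc).aestronglyMeasurable measurableSet_uIoc
  · exact Eventually.of_forall fun h => Eventually.of_forall fun s _ =>
      (P s).abs_two_inner_diffQuot_le hf hg h
  · refine ContinuousOn.intervalIntegrable ?_
    rw [hu]
    refine ContinuousOn.mono ?_ hsub
    exact (continuousOn_const.mul (hP.W.norm.mul (hP.dsource hf hg).norm)).add
      (continuousOn_const.mul ((hP.dcomp hg).norm.mul (hP.W.norm.pow 2)))
  · exact Eventually.of_forall fun s _ => (P s).tendsto_two_inner_diffQuot hf hg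

/-- The balance of `∫ (m² + m_x²)`. -/
theorem hasDerivWithinAt_energy {T : ℝ} (hP : ContinuousProfileOn P (Ico 0 T))
    (hd : ∀ t ∈ Ico 0 T,
      HasDerivWithinAt (fun s => (P s).M) ((P t).momentumRate hf hg) (Ico 0 T) t)
    {t : ℝ} (ht : t ∈ Ico 0 T) :
    HasDerivWithinAt (fun s => ‖(P s).M‖ ^ 2 + ‖(P s).W‖ ^ 2) (-(P t).dissipation hf hg)
      (Ico 0 T) t := by
  have h1 := (hd t ht).norm_sq
  have hc : ContinuousOn (fun s => -2 * ⟪(P s).W, (P s).dsource hf hg⟫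
      - (P s).formWW ((P s).dcomp g hg)) (Ico 0 T) :=
    (continuousOn_const.mul (hP.W.inner (𝕜 := ℝ) (hP.dsource hf hg))).sub
      (((hP.dcomp hg).clm_apply₂ mulB hP.W).inner (𝕜 := ℝ) hP.W)
  have h2 := hasDerivWithinAt_of_eq_integral (E := fun s => ‖(P s).W‖ ^ 2) hc
    (fun s hs => hP.norm_sq_sub_eq_integral hf hg hd hs) ht
  refine (h1.add h2).congr_deriv ?_
  rw [(P t).two_inner_momentumRate hf hg, ← (P t).energy_identity hf hg]
  ring

end ContinuousProfileOn

/-! ### Profiles of `H³` functions -/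

lemma HasWeakDeriv.sub {M W N Z : L2R} (h : HasWeakDeriv M W) (h' : HasWeakDeriv N Z) :
    HasWeakDeriv (M - N : L2R) (W - Z : L2R) := by
  refine (h.add (h'.smul (-1))).congr ?_ ?_
  · filter_upwards [Lp.coeFn_sub M N] with x hx
    rw [hx]; simp [sub_eq_add_neg]
  · filter_upwards [Lp.coeFn_sub W Z] with x hx
    rw [hx]; simp [sub_eq_add_neg]

/-- The profile `P` describes the function `v` of class `V`. -/
structure IsProfileOf (P : Profile) (v : ℝ → ℝ) (V : SobolevH 3) : Prop where
  u_eq : ⇑P.u = v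
  p_eq : ⇑P.p = deriv v
  m_eq : ⇑P.m = momentum v
  M_eq : P.M = V.1 0 - V.1 2
  W_eq : P.W = V.1 1 - V.1 3
  ae_u : P.u =ᵐ[volume] V.1 0
  ae_p : P.p =ᵐ[volume] V.1 1

namespace SobolevH

variable (V : SobolevH 3)

lemma weak_zero : HasWeakDeriv (V.1 0) (V.1 1) := V.2 0

lemma weak_one : HasWeakDeriv (V.1 1) (V.1 2) := V.2 1

lemma weak_two : HasWeakDeriv (V.1 2) (V.1 3) := V.2 2

lemma norm_sq_eq :
    ‖V‖ ^ 2 = ‖V.1 0‖ ^ 2 + ‖V.1 1‖ ^ 2 + ‖V.1 2‖ ^ 2 + ‖V.1 3‖ ^ 2 := by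
  rw [Submodule.coe_norm, PiLp.norm_sq_eq_of_L2, Fin.sum_univ_four]

lemma norm_apply_le (j : Fin 4) : ‖V.1 j‖ ≤ ‖V‖ := PiLp.norm_apply_le V.1 j

lemma continuous_apply (j : Fin 4) : Continuous fun V : SobolevH 3 => V.1 j :=
  (PiLp.continuous_apply 2 (fun _ : Fin 4 => L2R) j).comp continuous_subtype_val

/-- The `H³` norm of `v` is controlled by the `H¹` norm of `v - v_xx`. -/
lemma norm_sq_le : ‖V‖ ^ 2 ≤ ‖V.1 0 - V.1 2‖ ^ 2 + ‖V.1 1 - V.1 3‖ ^ 2 := by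
  have h0 := (SobolevH.weak_zero V).hasStrongDeriv
  have h1 := (SobolevH.weak_one V).hasStrongDeriv
  have h2 := (SobolevH.weak_two V).hasStrongDeriv
  -- `⟨v, v''⟩ = -‖v'‖²` and `⟨v', v'''⟩ = -‖v''‖²`, so the cross terms of the expanded squares are
  -- nonnegative.
  have i1 := h0.inner_add_inner h1
  have i2 := h1.inner_add_inner h2
  rw [real_inner_self_eq_norm_sq] at i1 i2
  rw [norm_sq_eq, norm_sub_sq_real, norm_sub_sq_real]
  nlinarith [sq_nonneg ‖V.1 1‖, sq_nonneg ‖V.1 2‖]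

/-- Uniqueness of weak derivatives identifies the classical derivatives of the `C²` representative
with the stored classes. -/
lemma exists_isProfileOf {v : ℝ → ℝ} (hv : ContDiff ℝ 2 v) (hV : Represents v V) :
    ∃ P : Profile, IsProfileOf P v V := by
  have hv' : ContDiff ℝ 1 (deriv v) := ((contDiff_succ_iff_deriv (n := 1)).1 hv).2.2
  have hv1 : ContDiff ℝ 1 v := hv.of_le (by norm_num)
  have a0 : v =ᵐ[volume] V.1 0 := hV
  have a1 : deriv v =ᵐ[volume] V.1 1 :=
    ((HasWeakDeriv.of_contDiff hv1).congr a0 .rfl).unique (SobolevH.weak_zero V)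
  have a2 : deriv (deriv v) =ᵐ[volume] V.1 2 :=
    ((HasWeakDeriv.of_contDiff hv').congr a1 .rfl).unique (SobolevH.weak_one V)
  have am : momentum v =ᵐ[volume] (V.1 0 - V.1 2 : L2R) := by
    filter_upwards [a0, a2, Lp.coeFn_sub (V.1 0) (V.1 2)] with x h1 h2 h3
    rw [h3, Pi.sub_apply, ← h1, ← h2, momentum]
  have s0 := (SobolevH.weak_zero V).hasStrongDeriv
  have s1 := (SobolevH.weak_one V).hasStrongDeriv
  have sm := ((SobolevH.weak_zero V).sub (SobolevH.weak_two V)).hasStrongDeriv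
  have cm : Continuous (momentum v) := hv.continuous.sub (hv'.continuous_deriv le_rfl)
  have d0 : ∀ x, HasDerivAt v (deriv v x) x := fun x =>
    ((hv1.differentiable (by simp)) x).hasDerivAt
  have d1 : ∀ x, HasDerivAt (deriv v) (deriv (deriv v) x) x := fun x =>
    ((hv'.differentiable (by simp)) x).hasDerivAt
  exact ⟨{
    u := s0.bcf hv.continuous a0
    p := s1.bcf hv'.continuous a1
    m := sm.bcf cm am
    M := V.1 0 - V.1 2
    W := V.1 1 - V.1 3
    deriv_u := d0
    deriv_p := fun x => (d1 x).congr_deriv (sub_sub_cancel (v x) _).symm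
    ae_eq_M := am
    strong := sm
    tendsto_u := s0.tendsto_bshift (b := s0.bcf hv.continuous a0) a0
    tendsto_p := s1.tendsto_bshift (b := s1.bcf hv'.continuous a1) a1 },
    rfl, rfl, rfl, rfl, rfl, a0, a1⟩

end SobolevH

namespace IsProfileOf

variable {P : Profile} {v : ℝ → ℝ} {V : SobolevH 3}
  {f g : ℝ × ℝ → ℝ} (hf : ContDiff ℝ ∞ f) (hg : ContDiff ℝ ∞ g)

lemma jet_eq (hP : IsProfileOf P v V) (x : ℝ) : jet v x = (P.u x, P.p x) := by
  rw [hP.u_eq, hP.p_eq, jet]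

lemma funA_eq (hP : IsProfileOf P v V) (x : ℝ) : funA f g v x = P.coefA hf hg x := by
  simp [funA, Profile.coefA, hP.jet_eq, hP.m_eq]

lemma funB_eq (hP : IsProfileOf P v V) (x : ℝ) : funB f g v x = P.coefB hf hg x := by
  simp [funB, Profile.coefB, hP.jet_eq, hP.m_eq]

lemma hasWeakDeriv (hP : IsProfileOf P v V) : HasWeakDeriv (momentum v) P.W := by
  have h := (SobolevH.weak_zero V).sub (SobolevH.weak_two V)
  rw [← hP.M_eq, ← hP.W_eq] at h
  refine h.congr ?_ .rfl
  rw [← hP.m_eq]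
  exact P.ae_eq_M.symm

/-- The constant `4` is what `m` needs, being estimated by four components of `V`; using it for `u`
and `u_x` too gives one common radius. -/
lemma norm_u_le (hP : IsProfileOf P v V) : ‖P.u‖ ≤ 4 * ‖V‖ := by
  have := (SobolevH.weak_zero V).hasStrongDeriv.norm_bcf_le hP.ae_u
  linarith [SobolevH.norm_apply_le V 0, SobolevH.norm_apply_le V 1, norm_nonneg V]

lemma norm_p_le (hP : IsProfileOf P v V) : ‖P.p‖ ≤ 4 * ‖V‖ := by
  have := (SobolevH.weak_one V).hasStrongDeriv.norm_bcf_le hP.ae_p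
  linarith [SobolevH.norm_apply_le V 1, SobolevH.norm_apply_le V 2, norm_nonneg V]

lemma norm_m_le (hP : IsProfileOf P v V) : ‖P.m‖ ≤ 4 * ‖V‖ := by
  have := P.strong.norm_bcf_le P.ae_eq_M
  rw [hP.M_eq, hP.W_eq] at this
  linarith [SobolevH.norm_apply_le V 0, SobolevH.norm_apply_le V 1, SobolevH.norm_apply_le V 2, SobolevH.norm_apply_le V 3,
    norm_sub_le (V.1 0) (V.1 2), norm_sub_le (V.1 1) (V.1 3)]

end IsProfileOf

/-- A curve that is continuous in `H³` is a continuous curve of profiles. -/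
lemma continuousProfileOn_of_isProfileOf {P : ℝ → Profile} {S : Set ℝ} {u : ℝ → ℝ → ℝ}
    {U : ℝ → SobolevH 3} (hU : ContinuousOn U S) (hP : ∀ t ∈ S, IsProfileOf (P t) (u t) (U t)) :
    ContinuousProfileOn P S := by
  have c : ∀ j, ContinuousOn (fun t => (U t).1 j) S := fun j =>
    (SobolevH.continuous_apply j).comp_continuousOn hU
  have hM : ContinuousOn (fun t => (P t).M) S :=
    ((c 0).sub (c 2)).congr fun t ht => (hP t ht).M_eq
  have hW : ContinuousOn (fun t => (P t).W) S :=
    ((c 1).sub (c 3)).congr fun t ht => (hP t ht).W_eq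
  refine ⟨fun t ht => ?_, fun t ht => ?_, fun t ht => ?_, hM, hW⟩
  · refine tendsto_bcf ?_ (SobolevH.weak_zero (U t)).hasStrongDeriv (hP t ht).ae_u (c 0 t ht) (c 1 t ht)
    filter_upwards [self_mem_nhdsWithin] with s hs
    exact ⟨(SobolevH.weak_zero (U s)).hasStrongDeriv, (hP s hs).ae_u⟩
  · refine tendsto_bcf ?_ (SobolevH.weak_one (U t)).hasStrongDeriv (hP t ht).ae_p (c 1 t ht) (c 2 t ht)
    filter_upwards [self_mem_nhdsWithin] with s hs
    exact ⟨(SobolevH.weak_one (U s)).hasStrongDeriv, (hP s hs).ae_p⟩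
  · refine tendsto_bcf ?_ (P t).strong (P t).ae_eq_M (hM t ht) (hW t ht)
    exact Eventually.of_forall fun s => ⟨(P s).strong, (P s).ae_eq_M⟩

/-! ### Energy and dissipation as integrals -/

namespace Profile

variable (P : Profile) {f g : ℝ × ℝ → ℝ} (hf : ContDiff ℝ ∞ f) (hg : ContDiff ℝ ∞ g)

lemma integrable_energy : Integrable fun x => P.m x ^ 2 + P.W x ^ 2 := by
  refine ((integrable_mul_L2R P.M P.M).add (integrable_mul_L2R P.W P.W)).congr ?_
  filter_upwards [P.ae_eq_M] with x hx
  simp only [Pi.add_apply, hx]; ring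

lemma integral_energy : ∫ x, (P.m x ^ 2 + P.W x ^ 2) = ‖P.M‖ ^ 2 + ‖P.W‖ ^ 2 := by
  rw [← real_inner_self_eq_norm_sq, ← real_inner_self_eq_norm_sq, inner_L2R, inner_L2R,
    ← integral_add (integrable_mul_L2R P.M P.M) (integrable_mul_L2R P.W P.W)]
  refine integral_congr_ae ?_
  filter_upwards [P.ae_eq_M] with x hx
  rw [hx]; ring

lemma integrable_dissipation :
    Integrable fun x => P.coefA hf hg x * P.m x ^ 2 + P.coefB hf hg x * P.W x ^ 2 := by
  refine ((integrable_mulB (P.coefA hf hg) P.M P.M).add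
    (integrable_mulB (P.coefB hf hg) P.W P.W)).congr ?_
  filter_upwards [P.ae_eq_M] with x hx
  simp only [Pi.add_apply, hx]; ring

lemma integral_dissipation :
    ∫ x, (P.coefA hf hg x * P.m x ^ 2 + P.coefB hf hg x * P.W x ^ 2) = P.dissipation hf hg := by
  rw [dissipation, formMM, formWW, inner_mulB, inner_mulB,
    ← integral_add (integrable_mulB _ _ _) (integrable_mulB _ _ _)]
  refine integral_congr_ae ?_
  filter_upwards [P.ae_eq_M] with x hx
  rw [hx]; ring

lemma le_dissipation {c : ℝ} (hA : ∀ x, c ≤ P.coefA hf hg x) (hB : ∀ x, c ≤ P.coefB hf hg x) :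
    c * (‖P.M‖ ^ 2 + ‖P.W‖ ^ 2) ≤ P.dissipation hf hg := by
  rw [← integral_energy, ← integral_dissipation, ← integral_const_mul]
  refine integral_mono (P.integrable_energy.const_mul c) (P.integrable_dissipation hf hg)
    fun x => ?_
  have := mul_le_mul_of_nonneg_right (hA x) (sq_nonneg (P.m x))
  have := mul_le_mul_of_nonneg_right (hB x) (sq_nonneg (P.W x))
  dsimp only
  linarith

end Profile

/-- `A` and `B` are bounded on bounded subsets of `H³`. -/
lemma exists_bound_coef {f g : ℝ × ℝ → ℝ} (hf : ContDiff ℝ ∞ f) (hg : ContDiff ℝ ∞ g) (R : ℝ) :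
    ∃ K : ℝ, ∀ P : Profile, ‖P.u‖ ≤ R → ‖P.p‖ ≤ R → ‖P.m‖ ≤ R →
      ∀ x, |P.coefA hf hg x| ≤ K ∧ |P.coefB hf hg x| ≤ K := by
  let a : (ℝ × ℝ) × ℝ → ℝ := fun z => coeffA0 f g z.1 + coeffA1 f g z.1 * z.2
    + coeffA2 f g z.1 * z.2 ^ 2 + coeffA3 g z.1 * z.2 ^ 3
  let b : (ℝ × ℝ) × ℝ → ℝ := fun z => coeffB0 f g z.1 + coeffB1 g z.1 * z.2
  have c0 := (hf.coeffA0 hg).continuous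
  have c1 := (hf.coeffA1 hg).continuous
  have c2 := (hf.coeffA2 hg).continuous
  have c3 := (ContDiff.coeffA3 hg).continuous
  have e0 := (hf.coeffB0 hg).continuous
  have e1 := (ContDiff.coeffB1 hg).continuous
  have ha : Continuous a := by fun_prop
  have hb : Continuous b := by fun_prop
  have hK := isCompact_closedBall (0 : (ℝ × ℝ) × ℝ) R
  obtain ⟨K₁, h1⟩ := hK.exists_bound_of_continuousOn ha.continuousOn
  obtain ⟨K₂, h2⟩ := hK.exists_bound_of_continuousOn hb.continuousOn
  refine ⟨max K₁ K₂, fun P hu hp hm x => ?_⟩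
  have hz : ((P.u x, P.p x), P.m x) ∈ Metric.closedBall (0 : (ℝ × ℝ) × ℝ) R := by
    rw [mem_closedBall_zero_iff, Prod.norm_def, Prod.norm_def]
    exact max_le (max_le ((P.u.norm_coe_le_norm x).trans hu) ((P.p.norm_coe_le_norm x).trans hp))
      ((P.m.norm_coe_le_norm x).trans hm)
  exact ⟨(h1 _ hz).trans (le_max_left _ _), (h2 _ hz).trans (le_max_right _ _)⟩

/-! ### Blow-up -/

lemma sobolevNorm_le {v : ℝ → ℝ} {V : SobolevH 3} (hV : Represents v V) :
    sobolevNorm 3 v ≤ ‖V‖ₑ := iInf₂_le V hV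

/-- Gronwall's inequality for `E' ≤ C E` on a bounded interval. -/
lemma le_exp_mul_of_hasDerivAt_le {E E' : ℝ → ℝ} {a T C : ℝ} (hC : 0 ≤ C)
    (hE : ∀ t ∈ Ioo a T, HasDerivAt E (E' t) t) (hle : ∀ t ∈ Ioo a T, E' t ≤ C * E t)
    {s t : ℝ} (hs : s ∈ Ioo a T) (ht : t ∈ Ico s T) (hEs : 0 ≤ E s) :
    E t ≤ Real.exp (C * (T - s)) * E s := by
  -- With the integrating factor `exp (-C r)`, the product with `E` is nonincreasing.
  have hd : ∀ r ∈ Ioo a T, HasDerivAt (fun r => Real.exp (-(C * r)) * E r)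
      (Real.exp (-(C * r)) * (E' r - C * E r)) r := fun r hr => by
    have h1 : HasDerivAt (fun r => Real.exp (-(C * r))) (Real.exp (-(C * r)) * -C) r := by
      have := ((hasDerivAt_id r).const_mul C).neg.exp
      simpa using this
    exact (h1.mul (hE r hr)).congr_deriv (by ring)
  have hanti : AntitoneOn (fun r => Real.exp (-(C * r)) * E r) (Ioo a T) := by
    refine antitoneOn_of_deriv_nonpos (convex_Ioo a T)
      (fun r hr => (hd r hr).continuousAt.continuousWithinAt) (fun r hr => ?_) (fun r hr => ?_)
    · rw [interior_Ioo] at hr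
      exact (hd r hr).differentiableAt.differentiableWithinAt
    · rw [interior_Ioo] at hr
      rw [(hd r hr).deriv]
      exact mul_nonpos_of_nonneg_of_nonpos (Real.exp_pos _).le (by linarith [hle r hr])
  have h := hanti hs ⟨hs.1.trans_le ht.1, ht.2⟩ ht.1
  have h' := mul_le_mul_of_nonneg_left h (Real.exp_pos (C * t)).le
  dsimp only at h'
  rw [← mul_assoc, ← mul_assoc, ← Real.exp_add, ← Real.exp_add, add_neg_cancel, Real.exp_zero,
    one_mul] at h'
  refine h'.trans ?_
  gcongr
  nlinarith [ht.2]

lemma exists_eventually_le_of_liminf_ne_bot {l : Filter ℝ} {F : ℝ → ℝ → ℝ}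
    (h : liminf (fun t => ⨅ x : ℝ, ((F t x : ℝ) : EReal)) l ≠ ⊥) :
    ∃ c : ℝ, ∀ᶠ t in l, ∀ x, c ≤ F t x := by
  obtain ⟨c, -, hc⟩ := EReal.lt_iff_exists_real_btwn.1 (bot_lt_iff_ne_bot.2 h)
  refine ⟨c, (eventually_lt_of_lt_liminf hc).mono fun t ht x => ?_⟩
  exact EReal.coe_le_coe_iff.1 (ht.le.trans (iInf_le _ x))

lemma liminf_ne_bot_of_eventually_le {l : Filter ℝ} {F : ℝ → ℝ → ℝ} {c : ℝ}
    (h : ∀ᶠ t in l, ∀ x, c ≤ F t x) :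
    liminf (fun t => ⨅ x : ℝ, ((F t x : ℝ) : EReal)) l ≠ ⊥ := by
  have : (c : EReal) ≤ liminf (fun t => ⨅ x : ℝ, ((F t x : ℝ) : EReal)) l :=
    le_liminf_of_le (by isBoundedDefault)
      (h.mono fun t ht => le_iInf fun x => EReal.coe_le_coe_iff.2 (ht x))
  exact ne_bot_of_le_ne_bot (EReal.coe_ne_bot c) this

/-! ### Classical solutions as curves of profiles -/

section Solution

variable {f g : ℝ × ℝ → ℝ} (hf : ContDiff ℝ ∞ f) (hg : ContDiff ℝ ∞ g) {T : ℝ} {u : ℝ → ℝ → ℝ}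

/-- A classical solution is a continuous curve of profiles that solves the equation. -/
lemma IsClassicalSolution.exists_profile (hT : 0 < T) (hu : IsClassicalSolution f g T u) :
    ∃ (P : ℝ → Profile) (U : ℝ → SobolevH 3),
      (∀ t ∈ Ico 0 T, Represents (u t) (U t)) ∧ (∀ t ∈ Ico 0 T, IsProfileOf (P t) (u t) (U t)) ∧
      ContinuousProfileOn P (Ico 0 T) ∧ ∀ t ∈ Ico 0 T,
        HasDerivWithinAt (fun s => (P s).M) ((P t).momentumRate hf hg) (Ico 0 T) t := by
  obtain ⟨U, hUc, hU⟩ := hu.mem_H3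
  have hex : ∀ t ∈ Ico 0 T, ∃ P : Profile, IsProfileOf P (u t) (U t) := fun t ht =>
    SobolevH.exists_isProfileOf (U t) (hu.contDiff_two t ht) (hU t ht)
  -- A default profile for times outside `[0, T)`, so that `P` is total.
  obtain ⟨P₀, -⟩ := hex 0 ⟨le_rfl, hT⟩
  have hex' : ∀ t, ∃ P : Profile, t ∈ Ico 0 T → IsProfileOf P (u t) (U t) := fun t => by
    by_cases ht : t ∈ Ico 0 T
    · exact (hex t ht).imp fun P hP _ => hP
    · exact ⟨P₀, fun h => absurd h ht⟩
  choose P hP using hex'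
  refine ⟨P, U, hU, hP, continuousProfileOn_of_isProfileOf hUc.continuousOn hP, fun t ht => ?_⟩
  obtain ⟨M, Mt, hM⟩ := hu.equation
  have hMP : ∀ s ∈ Ico 0 T, (P s).M = M s := fun s hs => by
    apply Lp.ext
    refine (P s).ae_eq_M.symm.trans ?_
    rw [(hP s hs).m_eq]
    exact (hM s hs).1
  have hrate : Mt t = (P t).momentumRate hf hg := by
    refine (P t).eq_momentumRate hf hg ?_
    have := (hM t ht).2.2
    simpa only [(hP t ht).jet_eq, ← (hP t ht).m_eq] using this
  rw [← hrate]
  exact (hM t ht).2.1.congr hMP (hMP t ht)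

end Solution

end

/-! ### The main theorem -/

theorem mainTheorem5 (f g : ℝ × ℝ → ℝ) (hf : ContDiff ℝ ∞ f) (hg : ContDiff ℝ ∞ g)
    (T : ℝ) (hT : 0 < T) (u : ℝ → ℝ → ℝ) (hu : IsClassicalSolution f g T u) :
    (BlowsUpAt T u ↔
      ∃ α β : ℝ, 0 ≤ α ∧ 0 ≤ β ∧
        liminf (fun t => ⨅ x : ℝ, ((α * funA f g (u t) x + β * funB f g (u t) x : ℝ) : EReal))
          (𝓝[<] T) = ⊥) ∧
    (∃ mx : ℝ → ℝ → ℝ, ∀ t ∈ Ico 0 T,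
      HasWeakDeriv (momentum (u t)) (mx t) ∧
      Integrable (fun x => momentum (u t) x ^ 2 + mx t x ^ 2) ∧
      Integrable (fun x => funA f g (u t) x * momentum (u t) x ^ 2
        + funB f g (u t) x * mx t x ^ 2) ∧
      HasDerivWithinAt (fun s => ∫ x, (momentum (u s) x ^ 2 + mx s x ^ 2))
        (-∫ x, (funA f g (u t) x * momentum (u t) x ^ 2 + funB f g (u t) x * mx t x ^ 2))
        (Ico 0 T) t) := by
  obtain ⟨P, U, hU, hP, hPc, hPd⟩ := hu.exists_profile hf hg hT
  have hEd := fun t (ht : t ∈ Ico 0 T) => hPc.hasDerivWithinAt_energy hf hg hPd ht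
  have hev : ∀ᶠ t in 𝓝[<] T, t ∈ Ioo 0 T := Ioo_mem_nhdsLT hT
  refine ⟨⟨fun hblow => ?_, ?_⟩, fun t => (P t).W, fun t ht => ⟨(hP t ht).hasWeakDeriv, ?_, ?_, ?_⟩⟩
  · by_contra! hne
    -- The pairs `(1, 0)` and `(0, 1)` suffice: they bound `A` and `B` below separately.
    obtain ⟨a, ha⟩ := exists_eventually_le_of_liminf_ne_bot (hne 1 0 zero_le_one le_rfl)
    obtain ⟨b, hb⟩ := exists_eventually_le_of_liminf_ne_bot (hne 0 1 le_rfl zero_le_one)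
    simp only [one_mul, zero_mul, add_zero, zero_add] at ha hb
    obtain ⟨r, hrT, hr⟩ := (mem_nhdsLT_iff_exists_Ioo_subset' hT).1 ((ha.and hb).and hev)
    set C := max 0 (max (-a) (-b))
    have hsub : ∀ t ∈ Ioo r T, t ∈ Ico 0 T := fun t ht => Ioo_subset_Ico_self (hr ht).2
    have hderiv : ∀ t ∈ Ioo r T, HasDerivAt (fun s => ‖(P s).M‖ ^ 2 + ‖(P s).W‖ ^ 2)
        (-(P t).dissipation hf hg) t := fun t ht =>
      (hEd t (hsub t ht)).hasDerivAt (Ico_mem_nhds (hr ht).2.1 ht.2)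
    have hle : ∀ t ∈ Ioo r T, -(P t).dissipation hf hg ≤ C * (‖(P t).M‖ ^ 2 + ‖(P t).W‖ ^ 2) := by
      intro t ht
      have hp := hP t (hsub t ht)
      have l1 : -C ≤ a := by linarith [le_max_left (-a) (-b), le_max_right 0 (max (-a) (-b))]
      have l2 : -C ≤ b := by linarith [le_max_right (-a) (-b), le_max_right 0 (max (-a) (-b))]
      have := (P t).le_dissipation hf hg (c := -C)
        (fun x => by rw [← hp.funA_eq]; exact l1.trans ((hr ht).1.1 x))
        (fun x => by rw [← hp.funB_eq]; exact l2.trans ((hr ht).1.2 x))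
      linarith
    obtain ⟨s, hrs, hsT⟩ := exists_between (mem_Iio.1 hrT)
    set K := Real.exp (C * (T - s)) * (‖(P s).M‖ ^ 2 + ‖(P s).W‖ ^ 2)
    have hbound : ∀ᶠ t in 𝓝[<] T, sobolevNorm 3 (u t) ≤ ENNReal.ofReal √K := by
      filter_upwards [Ioo_mem_nhdsLT hsT] with t ht
      have ht' := hsub t ⟨hrs.trans ht.1, ht.2⟩
      have hE := le_exp_mul_of_hasDerivAt_le (le_max_left _ _) hderiv hle ⟨hrs, hsT⟩
        ⟨ht.1.le, ht.2⟩ (by positivity)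
      have hn := SobolevH.norm_sq_le (U t)
      rw [← (hP t ht').M_eq, ← (hP t ht').W_eq] at hn
      refine (sobolevNorm_le (hU t ht')).trans ?_
      rw [← ofReal_norm]
      exact ENNReal.ofReal_le_ofReal (Real.le_sqrt_of_sq_le (hn.trans hE))
    have hlim : limsup (fun t => sobolevNorm 3 (u t)) (𝓝[<] T) ≤ ENNReal.ofReal √K :=
      limsup_le_of_le (by isBoundedDefault) hbound
    rw [BlowsUpAt] at hblow
    rw [hblow] at hlim
    exact ENNReal.ofReal_ne_top (top_le_iff.1 hlim)
  · rintro ⟨α, β, hα, hβ, hlim⟩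
    by_contra hblow
    -- A finite `c` above the limsup bounds the `H³` norm near `T`; the radius `4 c` then contains
    -- `u`, `u_x` and `m`.
    obtain ⟨c, hc, hcT⟩ := exists_between (lt_top_iff_ne_top.2 hblow)
    obtain ⟨K, hK⟩ := exists_bound_coef hf hg (4 * c.toReal)
    refine liminf_ne_bot_of_eventually_le (c := -((α + β) * K)) ?_ hlim
    filter_upwards [hev, eventually_lt_of_limsup_lt hc] with t ht htc x
    have ht' := Ioo_subset_Ico_self ht
    -- The norm is an infimum over classes, so the bound yields some class `V` with its own profile
    -- `Q`; comparing `V` with `U t` is unnecessary.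
    simp only [sobolevNorm, iInf_lt_iff] at htc
    obtain ⟨V, hV, hVc⟩ := htc
    obtain ⟨Q, hQ⟩ := SobolevH.exists_isProfileOf V (hu.contDiff_two t ht') hV
    have hn : 4 * ‖V‖ ≤ 4 * c.toReal := by
      have := ENNReal.toReal_mono hcT.ne hVc.le
      rw [toReal_enorm] at this
      linarith
    obtain ⟨h1, h2⟩ := hK Q (hQ.norm_u_le.trans hn) (hQ.norm_p_le.trans hn)
      (hQ.norm_m_le.trans hn) x
    rw [hQ.funA_eq hf hg, hQ.funB_eq hf hg]
    nlinarith [(abs_le.1 h1).1, (abs_le.1 h2).1]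
  · simpa only [(hP t ht).m_eq] using (P t).integrable_energy
  · simpa only [(hP t ht).m_eq, (hP t ht).funA_eq hf hg, (hP t ht).funB_eq hf hg] using
      (P t).integrable_dissipation hf hg
  · have e : ∀ s ∈ Ico 0 T, ∫ x, (momentum (u s) x ^ 2 + (P s).W x ^ 2)
        = ‖(P s).M‖ ^ 2 + ‖(P s).W‖ ^ 2 := fun s hs => by
      rw [← (P s).integral_energy, (hP s hs).m_eq]
    refine ((hEd t ht).congr e (e t ht)).congr_deriv ?_
    rw [← (P t).integral_dissipation hf hg]
    simp only [(hP t ht).m_eq, (hP t ht).funA_eq hf hg, (hP t ht).funB_eq hf hg]
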